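/- **Conventions.** A ReLU network with $m$-dimensional input and $k$-dimensional output is a finite sequence $\Phi=((W_1,b_1),\dots,(W_L,b_L))$, $L\ge 1$, of weight matrices $W_i\in\mathbb R^{n_i\times n_{i-1}}$ and bias vectors $b_i\in\mathbb R^{n_i}$ with $n_0=m$, $n_L=k$. Its realization is $R(\Phi)(x)=x_L$, where $x_0=x$, $x_i=\sigma(W_ix_{i-1}+b_i)$ for $1\le i\le L-1$, $x_L=W_Lx_{L-1}+b_L$, and $\sigma(t)=\max\{0,t\}$ acts componentwise. Its depth is $L(\Phi)=L$, and $M(\Phi)=\sum_{i=1}^L(\|W_i\|_0+\|b_i\|_0)$ is its number of nonzero parameters. $\|\cdot\|_2$ is the Euclidean norm of vectors and the spectral norm of matrices, and $\mathrm{matr}(v)\in\mathbb R^{N\times n}$ is the matrix whose columns, stacked, form $v\in\mathbb R^{Nn}$. **Setting.** Let $N=N_I+N_B$ (numbers of interior and boundary nodes) and $\mathcal D\subset\mathbb R^p$. For $\mu\in\mathcal D$ let $L(\mu)\in\mathbb R^{N_I\times N}$ be the matrix of the discretized differential operator and $\mathbf f(\mu)\in\mathbb R^{N_I}$, $\mathbf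 g(\mu)\in\mathbb R^{N_B}$ the discretized data. Let $V\in\mathbb R^{N\times n_{\mathrm{POD}}}$ be a reduced basis, that is, a matrix with orthonormal columns (such as a POD basis). Put $$B_\mu=\begin{bmatrix}L(\mu)\\ \mathbf 0\;\;\, I_{N_B}\end{bmatrix}V\in\mathbb R^{N\times n_{\mathrm{POD}}},\qquad \mathbf c(\mu)=(B_\mu^TB_\mu)^{-1}B_\mu^T\begin{bmatrix}\mathbf f(\mu)\\ \mathbf g(\mu)\end{bmatrix}.$$ **Theorem.** Let $0<\beta<\alpha$ and $\gamma>0$. There are constants $C_L,C_M$ depending only on $\alpha,\beta,\gamma$ such that the following holds for all $p$, $N_I$, $N_B$, $n_{\mathrm{POD}}$, $\mathcal D$, $L(\cdot)$, $\mathbf f$, $\mathbf g$ and $V$ as above. Assume: 1. for all $\mu\in\mathcal D$, the spectrum of $B_\mu^TB_\mu$ lies in $[\beta^2,\alpha^2]$, and $\|(\mathbf f(\mu),\mathbf g(\mu))^T\|_2\le\gamma$; 2. for every $\eta>0$, $\Phi^B_{V,\eta}$ is a ReLU network with $p$-dimensional input and $Nn_{\mathrm{POD}}$-dimensional output such that $\sup_{\mu\in\mathcal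 D}\|B_\mu-\mathrm{matr}(R(\Phi^B_{V,\eta})(\mu))\|_2\le\eta$; write $L(B;V,\eta)$ and $M(B;V,\eta)$ for its depth and its number of nonzero parameters; 3. for every $\eta>0$, $\Phi^{\mathbf{fg}}_\eta$ is a ReLU network with $p$-dimensional input and $N$-dimensional output such that $\sup_{\mu\in\mathcal D}\|(\mathbf f(\mu),\mathbf g(\mu))^T-R(\Phi^{\mathbf{fg}}_\eta)(\mu)\|_2\le\eta$; write $L(\mathbf{fg};\eta)$ and $M(\mathbf{fg};\eta)$ for its depth and its number of nonzero parameters. Then for every $\varepsilon\in(0,1/4)$ there is a ReLU network $\Phi$ with $p$-dimensional input and $n_{\mathrm{POD}}$-dimensional output such that $$\sup_{\mu\in\mathcal D}\|\mathbf c(\mu)-R(\Phi)(\mu)\|_2\le\varepsilon,$$ $$\begin{aligned}L(\Phi)\le{}&C_L\log_2(\log_2(1/\varepsilon))\,(\log_2(1/\varepsilon)+\log_2n_{\mathrm{POD}})+C_L\log_2N\\&+L(B;V,\varepsilon_3)+L(B;V,\varepsilon_1)+L(\mathbf{fg};\varepsilon_2),\end{aligned}$$ $$\begin{aligned}M(\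Phi)\le{}&C_MNn_{\mathrm{POD}}^2(\log_2(1/\varepsilon)+\log_2N)\\&+C_Mn_{\mathrm{POD}}^2\log_2(1/\varepsilon)\,(\log_2(\log_2(1/\varepsilon))+n_{\mathrm{POD}})\,(\log_2(1/\varepsilon)+\log_2n_{\mathrm{POD}})\\&+C_Mn_{\mathrm{POD}}^2\log_2(\log_2(1/\varepsilon))\,\log_2N\\&+16M(B;V,\varepsilon_1)+16M(\mathbf{fg};\varepsilon_2)+8M(B;V,\varepsilon_3)\\&+80Nn_{\mathrm{POD}}L(B;V,\varepsilon_1)+80Nn_{\mathrm{POD}}L(\mathbf{fg};\varepsilon_2)+16n_{\mathrm{POD}}^2L(B;V,\varepsilon_3),\end{aligned}$$ where $$\varepsilon_1=\min\Big\{\tfrac{\varepsilon\beta^2}{12\gamma},\tfrac{\beta\sqrt\varepsilon}{4},\tfrac{\alpha}{4},\tfrac{\sqrt{\alpha\gamma}}{2}\Big\},\quad \varepsilon_2=\min\Big\{\tfrac{\varepsilon\beta^2}{12\alpha},\tfrac{\beta\sqrt\varepsilon}{4},\tfrac{\gamma}{4},\tfrac{\sqrt{\alpha\gamma}}{2}\Big\},$$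 $$\varepsilon_3=\min\Big\{\tfrac{\varepsilon\beta^4}{144\alpha^2\gamma},\tfrac{\beta^2\sqrt{6\alpha\gamma\varepsilon}}{24\alpha\gamma},\tfrac{\beta^2}{12\alpha},\tfrac{\beta}{3}\Big\}.$$ -/

import Mathlib

/-- A neural network with `m`-dimensional input and `k`-dimensional output: a nonempty finite
sequence `((W₁, b₁), …, (W_L, b_L))` of weight matrices and bias vectors of matching dimensions.
`output W b` is the sequence with the single entry `(W, b)`, and `layer W b Φ` puts the entry
`(W, b)` in front of the sequence `Φ`. -/
inductive ReLUNet : ℕ → ℕ → Type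
  | output {m k : ℕ} (W : Matrix (Fin k) (Fin m) ℝ) (b : Fin k → ℝ) : ReLUNet m k
  | layer {m l k : ℕ} (W : Matrix (Fin l) (Fin m) ℝ) (b : Fin l → ℝ) (Φ : ReLUNet l k) :
      ReLUNet m k

namespace ReLUNet

/-- The realization `R(Φ)`: the activation `σ(t) = max {0, t}` is applied componentwise after every
affine map except the last one. -/
def realize : {m k : ℕ} → ReLUNet m k → (Fin m → ℝ) → (Fin k → ℝ)
  | _, _, output W b, x => W.mulVec x + b
  | _, _, layer W b Φ, x => Φ.realize (fun i => max 0 ((W.mulVec x + b) i))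

/-- The number of layers `L(Φ)`. -/
def depth : {m k : ℕ} → ReLUNet m k → ℕ
  | _, _, output _ _ => 1
  | _, _, layer _ _ Φ => Φ.depth + 1

open Classical in
/-- The number `‖W‖₀ + ‖b‖₀` of nonzero entries of `W` and `b`. -/
noncomputable def nnz {m k : ℕ} (W : Matrix (Fin k) (Fin m) ℝ) (b : Fin k → ℝ) : ℕ :=
  (Finset.univ.filter fun q : Fin k × Fin m => W q.1 q.2 ≠ 0).card +
    (Finset.univ.filter fun i : Fin k => b i ≠ 0).card

/-- The number `M(Φ)` of nonzero parameters. -/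
noncomputable def numParams : {m k : ℕ} → ReLUNet m k → ℕ
  | _, _, output W b => nnz W b
  | _, _, layer W b Φ => nnz W b + Φ.numParams

end ReLUNet

namespace PODDNN

/-- The Euclidean norm of a vector. -/
noncomputable def vecNorm {k : ℕ} (v : Fin k → ℝ) : ℝ := ‖WithLp.toLp 2 v‖

open scoped Matrix.Norms.L2Operator in
/-- The spectral norm of a matrix (operator norm between Euclidean spaces). -/
noncomputable def specNorm {m k : ℕ} (A : Matrix (Fin m) (Fin k) ℝ) : ℝ := ‖A‖

/-- The `m × k` matrix whose columns, stacked on top of each other, form the vector `v`: the entry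
`(i, j)` is the coordinate of `v` with (zero-based) number `i + m * j`. -/
def matr {m k : ℕ} (v : Fin (k * m) → ℝ) : Matrix (Fin m) (Fin k) ℝ :=
  Matrix.of fun i j => v (finProdFinEquiv (j, i))

/-- The `N × N` matrix `[L; 0 | I]`, with `N = NI + NB`, of the discretized boundary value problem:
`L` gives the rows of the `NI` interior nodes, and the rows of the `NB` boundary nodes are those of
the identity matrix. -/
def systemMatrix {NI NB : ℕ} (L : Matrix (Fin NI) (Fin (NI + NB)) ℝ) :
    Matrix (Fin (NI + NB)) (Fin (NI + NB)) ℝ :=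
  Matrix.of (Fin.append L
    fun i : Fin NB => (1 : Matrix (Fin (NI + NB)) (Fin (NI + NB)) ℝ) (Fin.natAdd NI i))

/-- The reduced matrix `B = [L; 0 | I] V`. -/
def reducedMatrix {NI NB n : ℕ} (L : Matrix (Fin NI) (Fin (NI + NB)) ℝ)
    (V : Matrix (Fin (NI + NB)) (Fin n) ℝ) : Matrix (Fin (NI + NB)) (Fin n) ℝ :=
  systemMatrix L * V

/-- The least squares coefficients `(Bᵀ B)⁻¹ Bᵀ r`. -/
noncomputable def leastSquares {N n : ℕ} (B : Matrix (Fin N) (Fin n) ℝ) (r : Fin N → ℝ) :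
    Fin n → ℝ :=
  ((B.transpose * B)⁻¹ * B.transpose).mulVec r

/-- The tolerance `ε₁`. -/
noncomputable def tol₁ (α β γ ε : ℝ) : ℝ :=
  min (min (ε * β ^ 2 / (12 * γ)) (β * √ε / 4)) (min (α / 4) (√(α * γ) / 2))

/-- The tolerance `ε₂`. -/
noncomputable def tol₂ (α β γ ε : ℝ) : ℝ :=
  min (min (ε * β ^ 2 / (12 * α)) (β * √ε / 4)) (min (γ / 4) (√(α * γ) / 2))

/-- The tolerance `ε₃`. -/
noncomputable def tol₃ (α β γ ε : ℝ) : ℝ :=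
  min (min (ε * β ^ 4 / (144 * α ^ 2 * γ)) (β ^ 2 * √(6 * α * γ * ε) / (24 * α * γ)))
    (min (β ^ 2 / (12 * α)) (β / 3))

end PODDNN

/-!
The coefficients `c` solve the normal equations `A c = Bᵀ r` with `A = Bᵀ B`. A network can
evaluate `Bᵀ r` and `A` from approximations of `B` and `r`, and `A⁻¹` by the Newton iteration
`X ↦ X (2 - A X)`, started at `X = α⁻² I`.

*Products.* With `tent w = 1 - 2 |w|` one has `w ^ 2 = |w| - 1 / 4 + (tent w) ^ 2 / 4`. Iterating
this `m` times writes `a ^ 2 - b ^ 2` as a sum of absolute values of iterated tents, with an error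
of at most `4⁻ᵐ` on `[-1, 1]` (`sq_sub_sq_eq_tentSum`), and polarization gives products of numbers
in `[-Z, Z]` with error `Z ^ 2 / 4 ^ m` (`abs_mulApprox_sub_le`) from `m + 2` layers with `O(m)`
parameters (`NetFn.bilinear`).

*Inversion.* The residual `1 - A X` is squared by a Newton step. An arithmetic error made in one
step is not amplified by the later ones, so that the residual after `K` steps is at most
`(1 - θ ^ 2) ^ 2 ^ K` plus a multiple of the arithmetic error, with `θ = β ^ 2 / (2 α ^ 2)`
(`norm_residual_newtonApprox_iterate_le`). Hence a number of steps of order `log₂ (log₂ (1 / ε))`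
suffices. Each step consists of two matrix products of depth `O(log₂ (1 / ε) + log₂ n)`. The
approximate inverse need not be symmetric: only operator norms enter.

*Error.* If `G`, `X`, `y` approximate `A`, `G⁻¹`, `Bᵀ r`, then
`A (c - X y) = (Bᵀ r - y) + ((1 - G X) + (G - A) X) y`, and `A` is bounded below by `β ^ 2`
(`PODDNN.norm_sub_mulVec_le`). The tolerances `ε₁`, `ε₂`, `ε₃` make `Bᵀ r - y` and `(G - A) X y`
less than `ε β ^ 2 / 2` together, up to arithmetic errors; the arithmetic is run with accuracy
`κ ε`, where `κ` depends on `α`, `β`, `γ` only (`PODDNN.norm_leastSquares_sub_lsqApprox_le`).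

*Counting.* Concatenation of ReLU networks carries a signal `x` by the pair `max 0 x`,
`max 0 (-x)`. The bookkeeping is done for stacks of signed layers `x ↦ P σ(x) + Q σ(-x) + b`
(`NetFn`), for which depths and parameter counts simply add up. The factor two of the pairs is
paid only once, in the translation to a ReLU network (`NetFn.exists_reluNet`), and the given
networks enter with their own depth and size (`NetFn.of_reluNet`). Branches of different depths
are synchronized by identity layers at places where the signals are few
(`NetFn.exists_reluNet_lsqApprox`).
-/

/-! ### Signed layers and their parameter count -/

open Classical in
/-- The number of nonzero entries of a vector. -/
noncomputable def nz {ι : Type} [Fintype ι] (u : ι → ℝ) : ℕ := ∑ i, if u i = 0 then 0 else 1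

open Classical in
/-- `f` is an affine form in the positive and the negative parts of the coordinates, with at most
`c` nonzero coefficients. -/
def IsRow {ι : Type} [Fintype ι] (f : (ι → ℝ) → ℝ) (c : ℕ) : Prop :=
  ∃ (u v : ι → ℝ) (b : ℝ),
    (∀ x, f x = ∑ i, u i * max 0 (x i) + ∑ i, v i * max 0 (-x i) + b) ∧
      nz u + nz v + (if b = 0 then 0 else 1) ≤ c

/-- `T` is a signed layer `x ↦ P σ(x) + Q σ(-x) + b` with at most `c` nonzero parameters. -/
def IsLayer {ι κ : Type} [Fintype ι] [Fintype κ] (T : (ι → ℝ) → κ → ℝ) (c : ℕ) : Prop :=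
  ∃ r : κ → ℕ, (∀ k, IsRow (fun x => T x k) (r k)) ∧ ∑ k, r k ≤ c

section Rows

variable {ι : Type} [Fintype ι]

lemma nz_add_le (u v : ι → ℝ) : nz (fun i => u i + v i) ≤ nz u + nz v := by
  classical
  unfold nz
  rw [← Finset.sum_add_distrib]
  refine Finset.sum_le_sum fun i _ => ?_
  by_cases hu : u i = 0 <;> by_cases hv : v i = 0 <;> simp [hu, hv]
  split <;> omega

lemma nz_smul_le (a : ℝ) (u : ι → ℝ) : nz (fun i => a * u i) ≤ nz u := by
  classical
  unfold nz
  refine Finset.sum_le_sum fun i _ => ?_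
  by_cases hu : u i = 0 <;> simp [hu]
  split <;> omega

lemma nz_zero : nz (fun _ : ι => (0 : ℝ)) = 0 := by simp [nz]

lemma nz_single_le [DecidableEq ι] (i : ι) : nz (fun j => if j = i then (1 : ℝ) else 0) ≤ 1 := by
  classical
  simp [nz]

lemma nz_neg (u : ι → ℝ) : nz (fun i => -u i) = nz u := by simp [nz]

lemma nz_sum_type {κ : Type} [Fintype κ] (u : ι ⊕ κ → ℝ) :
    nz u = nz (fun i => u (.inl i)) + nz (fun k => u (.inr k)) := by
  classical
  simp [nz, Fintype.sum_sum_type]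

lemma nz_comp_equiv {κ : Type} [Fintype κ] (u : ι → ℝ) (e : κ ≃ ι) :
    nz (fun k => u (e k)) = nz u := by
  classical
  exact e.sum_comp fun i => if u i = 0 then 0 else 1

lemma IsRow.mono {f : (ι → ℝ) → ℝ} {c c' : ℕ} (h : IsRow f c) (hc : c ≤ c') : IsRow f c' := by
  obtain ⟨u, v, b, h1, h2⟩ := h
  exact ⟨u, v, b, h1, h2.trans hc⟩

lemma IsRow.const (b : ℝ) : IsRow (fun _ : ι → ℝ => b) 1 :=
  ⟨fun _ => 0, fun _ => 0, b, by simp, by simp only [nz_zero]; split <;> simp⟩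

lemma IsRow.zero : IsRow (fun _ : ι → ℝ => 0) 0 :=
  ⟨fun _ => 0, fun _ => 0, 0, by simp, by simp [nz_zero]⟩

lemma IsRow.pos (i : ι) : IsRow (fun x : ι → ℝ => max 0 (x i)) 1 := by
  classical
  exact ⟨fun j => if j = i then 1 else 0, fun _ => 0, 0, by simp, by
    simpa [nz_zero] using nz_single_le i⟩

lemma IsRow.neg (i : ι) : IsRow (fun x : ι → ℝ => max 0 (-x i)) 1 := by
  classical
  exact ⟨fun _ => 0, fun j => if j = i then 1 else 0, 0, by simp, by
    simpa [nz_zero] using nz_single_le i⟩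

lemma IsRow.add {f g : (ι → ℝ) → ℝ} {c c' : ℕ} (hf : IsRow f c) (hg : IsRow g c') :
    IsRow (fun x => f x + g x) (c + c') := by
  classical
  obtain ⟨u, v, b, h1, h2⟩ := hf
  obtain ⟨u', v', b', h1', h2'⟩ := hg
  refine ⟨fun i => u i + u' i, fun i => v i + v' i, b + b', fun x => ?_, ?_⟩
  · simp only [h1, h1']
    simp only [add_mul, Finset.sum_add_distrib]
    ring
  · have := nz_add_le u u'
    have := nz_add_le v v'
    have : (if b + b' = 0 then 0 else 1) ≤
        (if b = 0 then 0 else 1) + (if b' = 0 then 0 else 1) := by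
      by_cases hb : b = 0 <;> by_cases hb' : b' = 0 <;> simp [hb, hb']
      split <;> omega
    omega

lemma IsRow.smul {f : (ι → ℝ) → ℝ} {c : ℕ} (a : ℝ) (hf : IsRow f c) :
    IsRow (fun x => a * f x) c := by
  classical
  obtain ⟨u, v, b, h1, h2⟩ := hf
  refine ⟨fun i => a * u i, fun i => a * v i, a * b, fun x => ?_, ?_⟩
  · simp only [h1]
    simp only [mul_assoc, ← Finset.mul_sum]
    ring
  · have := nz_smul_le a u
    have := nz_smul_le a v
    have : (if a * b = 0 then 0 else 1) ≤ (if b = 0 then 0 else 1) := by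
      by_cases hb : b = 0 <;> simp [hb]
      split <;> omega
    omega

lemma IsRow.sum {S : Type} (s : Finset S) {f : S → (ι → ℝ) → ℝ} {c : S → ℕ}
    (hf : ∀ j, IsRow (f j) (c j)) : IsRow (fun x => ∑ j ∈ s, f j x) (∑ j ∈ s, c j) := by
  classical
  induction s using Finset.induction_on with
  | empty => simpa using IsRow.zero
  | insert a s ha ih => simpa [Finset.sum_insert ha] using (hf a).add ih

lemma IsRow.coord (i : ι) : IsRow (fun x : ι → ℝ => x i) 2 := by
  have h := (IsRow.pos i).add ((IsRow.neg i).smul (-1))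
  convert h using 2 with x
  rcases le_total 0 (x i) with h | h
  · rw [max_eq_right h, max_eq_left (by linarith)]; ring
  · rw [max_eq_left h, max_eq_right (by linarith)]; ring

lemma IsRow.abs (i : ι) : IsRow (fun x : ι → ℝ => |x i|) 2 := by
  have h := (IsRow.pos i).add (IsRow.neg i)
  convert h using 2 with x
  rcases le_total 0 (x i) with h | h
  · rw [max_eq_right h, max_eq_left (by linarith), abs_of_nonneg h]; ring
  · rw [max_eq_left h, max_eq_right (by linarith), abs_of_nonpos h]; ring

/-- Reading the coordinates of another input through a map of indices costs nothing. -/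
lemma IsRow.comp_reindex {κ : Type} [Fintype κ] {f : (ι → ℝ) → ℝ} {c : ℕ} (hf : IsRow f c)
    (π : ι → κ) : IsRow (fun x : κ → ℝ => f fun i => x (π i)) c := by
  classical
  obtain ⟨u, v, b, h1, h2⟩ := hf
  have key : ∀ (w : ι → ℝ) (g : ι → (κ → ℝ) → ℝ), (∀ i, IsRow (g i) 1) →
      IsRow (fun x => ∑ i, w i * g i x) (nz w) := by
    intro w g hg
    refine IsRow.sum Finset.univ fun i => ?_
    by_cases hw : w i = 0
    · simpa [hw] using IsRow.zero
    · simpa [hw] using (hg i).smul (w i)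
  have hb : IsRow (fun _ : κ → ℝ => b) (if b = 0 then 0 else 1) := by
    by_cases hb : b = 0
    · simpa [hb] using IsRow.zero
    · simpa [hb] using IsRow.const b
  simp only [h1]
  exact (((key u _ fun i => IsRow.pos (π i)).add (key v _ fun i => IsRow.neg (π i))).add hb).mono h2

end Rows

section Layers

variable {ι κ ι' κ' : Type} [Fintype ι] [Fintype κ] [Fintype ι'] [Fintype κ']

lemma IsLayer.mono {T : (ι → ℝ) → κ → ℝ} {c c' : ℕ} (h : IsLayer T c) (hc : c ≤ c') :
    IsLayer T c' := by
  obtain ⟨r, h1, h2⟩ := h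
  exact ⟨r, h1, h2.trans hc⟩

lemma IsLayer.of_rows {T : (ι → ℝ) → κ → ℝ} {c : ℕ} (h : ∀ k, IsRow (fun x => T x k) c) :
    IsLayer T (Fintype.card κ * c) :=
  ⟨fun _ => c, h, by simp⟩

lemma IsLayer.elim {T : (ι → ℝ) → κ → ℝ} {T' : (ι → ℝ) → κ' → ℝ} {c c' : ℕ} (h : IsLayer T c)
    (h' : IsLayer T' c') : IsLayer (fun x => Sum.elim (T x) (T' x)) (c + c') := by
  obtain ⟨r, h1, h2⟩ := h
  obtain ⟨r', h1', h2'⟩ := h'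
  refine ⟨Sum.elim r r', ?_, ?_⟩
  · rintro (k | k)
    · exact h1 k
    · exact h1' k
  · simp only [Fintype.sum_sum_type, Sum.elim_inl, Sum.elim_inr]
    omega

lemma IsLayer.comp_reindex {T : (ι → ℝ) → κ → ℝ} {c : ℕ} (h : IsLayer T c) (π : ι → ι') :
    IsLayer (fun x : ι' → ℝ => T fun i => x (π i)) c := by
  obtain ⟨r, h1, h2⟩ := h
  exact ⟨r, fun k => (h1 k).comp_reindex π, h2⟩

end Layers

/-! ### Functions computed by stacks of signed layers -/

/-- `NetFn F d c`: the function `F` is an affine map followed by `d - 1` signed layers, with at most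
`c` nonzero parameters altogether. Depths and parameter counts of these functions add up under
composition. -/
inductive NetFn {p : ℕ} : {κ : Type} → [Fintype κ] → ((Fin p → ℝ) → κ → ℝ) → ℕ → ℕ → Prop
  | affine {κ : Type} [Fintype κ] (W : κ → Fin p → ℝ) (b : κ → ℝ) {c : ℕ}
      (hc : ∑ k, nz (W k) + nz b ≤ c) : NetFn (fun x k => ∑ i, W k i * x i + b k) 1 c
  | layer {ι κ : Type} [Fintype ι] [Fintype κ] {F : (Fin p → ℝ) → ι → ℝ} {d c c' : ℕ}
      {T : (ι → ℝ) → κ → ℝ} (hF : NetFn F d c) (hT : IsLayer T c') :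
      NetFn (fun x => T (F x)) (d + 1) (c + c')

namespace NetFn

variable {p : ℕ} {ι κ : Type} [Fintype ι] [Fintype κ]

lemma mono {F : (Fin p → ℝ) → κ → ℝ} {d c c' : ℕ} (h : NetFn F d c) (hc : c ≤ c') :
    NetFn F d c' := by
  cases h with
  | affine W b h => exact affine W b (h.trans hc)
  | @layer _ _ _ _ _ d c₀ c₁ T hF hT =>
    have := layer hF (hT.mono (show c₁ ≤ c' - c₀ by omega))
    rwa [show c₀ + (c' - c₀) = c' by omega] at this

lemma depth_pos {F : (Fin p → ℝ) → κ → ℝ} {d c : ℕ} (h : NetFn F d c) : 0 < d := by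
  cases h <;> omega

lemma affine_elim {κ' : Type} [Fintype κ'] (W : κ → Fin p → ℝ) (b : κ → ℝ)
    (W' : κ' → Fin p → ℝ) (b' : κ' → ℝ) {c c' : ℕ} (hc : ∑ k, nz (W k) + nz b ≤ c)
    (hc' : ∑ k, nz (W' k) + nz b' ≤ c') :
    NetFn (fun x => Sum.elim (fun k => ∑ i, W k i * x i + b k) fun k => ∑ i, W' k i * x i + b' k)
      1 (c + c') := by
  have h := affine (p := p) (Sum.elim W W') (Sum.elim b b') (c := c + c') (by
    rw [nz_sum_type]
    simp only [Fintype.sum_sum_type, Sum.elim_inl, Sum.elim_inr]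
    linarith)
  convert h using 2 with x
  ext (k | k) <;> rfl

/-- Two networks of the same depth run in parallel. -/
lemma pair {F : (Fin p → ℝ) → κ → ℝ} {d c : ℕ} (h : NetFn F d c) :
    ∀ {κ' : Type} [Fintype κ'] {G : (Fin p → ℝ) → κ' → ℝ} {c' : ℕ}, NetFn G d c' →
      NetFn (fun x => Sum.elim (F x) (G x)) d (c + c') := by
  induction h with
  | affine W b hc =>
    intro κ' _ G c' h'
    generalize hd : 1 = d at h'
    cases h' with
    | affine W' b' hc' => exact affine_elim W b W' b' hc hc'
    | layer hF hT => exact absurd hF.depth_pos (by omega)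
  | @layer ι κ _ _ F d c c₁ T hF hT ih =>
    intro κ' _ G c' h'
    generalize hd : d + 1 = d' at h'
    cases h' with
    | affine W' b' hc' => exact absurd hF.depth_pos (by omega)
    | @layer ι' _ _ _ F' d₂ c₂ c₃ T' hF' hT' =>
      obtain rfl : d = d₂ := by omega
      have := layer (ih hF') ((hT.comp_reindex Sum.inl).elim (hT'.comp_reindex Sum.inr))
      exact this.mono (by omega)

/-- Identity layers make a network deeper, at the price of two parameters for each output and
layer. -/
lemma pad {F : (Fin p → ℝ) → κ → ℝ} {d c : ℕ} (h : NetFn F d c) (l : ℕ) :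
    NetFn F (d + l) (c + l * (2 * Fintype.card κ)) := by
  induction l with
  | zero => simpa using h
  | succ l ih =>
    exact (layer ih (IsLayer.of_rows (T := fun x : κ → ℝ => x) fun k => IsRow.coord k)).mono
      (by rw [add_mul]; omega)

end NetFn

/-! ### Signed layers and ReLU networks -/

lemma ReLUNet.nnz_eq {m k : ℕ} (W : Matrix (Fin k) (Fin m) ℝ) (b : Fin k → ℝ) :
    ReLUNet.nnz W b = ∑ i, nz (W i) + nz b := by
  classical
  simp [ReLUNet.nnz, nz, Finset.card_filter, Fintype.sum_prod_type]

namespace NetFn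

variable {p : ℕ}

/-- A ReLU network that reads the positive part of the output of a stack prolongs the stack. -/
lemma comp_realize_relu {m k : ℕ} (Φ : ReLUNet m k) :
    ∀ {F : (Fin p → ℝ) → Fin m → ℝ} {d c : ℕ}, NetFn F d c →
      NetFn (fun x => Φ.realize fun i => max 0 (F x i)) (d + Φ.depth) (c + Φ.numParams) := by
  have aux : ∀ {m k : ℕ} (W : Matrix (Fin k) (Fin m) ℝ) (b : Fin k → ℝ),
      IsLayer (fun x : Fin m → ℝ => W.mulVec (fun i => max 0 (x i)) + b) (ReLUNet.nnz W b) := by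
    classical
    intro m k W b
    refine ⟨fun i => nz (W i) + if b i = 0 then 0 else 1, fun i => ?_, ?_⟩
    · exact ⟨W i, fun _ => 0, b i, fun x => by simp [Matrix.mulVec, dotProduct], by
        simp [nz_zero]⟩
    · rw [ReLUNet.nnz_eq, Finset.sum_add_distrib]
      rfl
  induction Φ with
  | output W b =>
    intro F d c h
    exact layer (T := fun x => W.mulVec (fun i => max 0 (x i)) + b) h (aux W b)
  | layer W b Φ ih =>
    intro F d c h
    have := ih (layer (T := fun x => W.mulVec (fun i => max 0 (x i)) + b) h (aux W b))
    simp only [ReLUNet.depth, ReLUNet.numParams, ReLUNet.realize]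
    rw [show d + (Φ.depth + 1) = d + 1 + Φ.depth by ring, ← add_assoc]
    exact this

/-- A ReLU network is a stack of signed layers that ignore the negative parts. -/
theorem of_reluNet {k : ℕ} (Φ : ReLUNet p k) : NetFn Φ.realize Φ.depth Φ.numParams := by
  cases Φ with
  | output W b => exact affine W b (ReLUNet.nnz_eq W b).ge
  | layer W b Φ =>
    have := comp_realize_relu Φ (affine W b (ReLUNet.nnz_eq W b).ge)
    simp only [ReLUNet.depth, ReLUNet.numParams]
    rw [add_comm Φ.depth]
    exact this

/-- The hidden layer that computes the positive and the negative parts of an affine map. -/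
lemma exists_layer {m k l : ℕ} {ι : Type} [Fintype ι] (e : Fin l ≃ ι ⊕ ι)
    (W : ι → Fin m → ℝ) (b : ι → ℝ) (Ψ : ReLUNet l k) :
    ∃ Φ : ReLUNet m k,
      (∀ x, Φ.realize x = Ψ.realize fun j => max 0 (Sum.elim (fun i => ∑ t, W i t * x t + b i)
        (fun i => -(∑ t, W i t * x t + b i)) (e j))) ∧
      Φ.depth = Ψ.depth + 1 ∧ Φ.numParams = 2 * (∑ i, nz (W i) + nz b) + Ψ.numParams := by
  refine ⟨.layer (fun j => Sum.elim W (fun i t => -W i t) (e j))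
    (fun j => Sum.elim b (fun i => -b i) (e j)) Ψ, fun x => ?_, rfl, ?_⟩
  · simp only [ReLUNet.realize]
    congr 1
    ext j
    rcases h : e j with i | i <;>
      simp [Matrix.mulVec, dotProduct, h, Finset.sum_neg_distrib]
    ring_nf
  · refine (congrArg (· + Ψ.numParams) (ReLUNet.nnz_eq _ _)).trans ?_
    rw [nz_comp_equiv (Sum.elim b fun i => -b i) e,
      e.sum_comp (fun q => nz (Sum.elim W (fun i t => -W i t) q)), nz_sum_type]
    simp only [Fintype.sum_sum_type, Sum.elim_inl, Sum.elim_inr, nz_neg]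
    ring

/-- A signed layer as an affine map of the positive and negative parts of its input. -/
lemma _root_.IsLayer.exists_affine {ι κ : Type} [Fintype ι] [Fintype κ]
    {T : (ι → ℝ) → κ → ℝ} {c l : ℕ} (h : IsLayer T c) (e : Fin l ≃ ι ⊕ ι) :
    ∃ (W : κ → Fin l → ℝ) (b : κ → ℝ),
      (∀ y k, T y k = ∑ j, W k j * max 0 (Sum.elim y (fun i => -y i) (e j)) + b k) ∧
        ∑ k, nz (W k) + nz b ≤ c := by
  classical
  obtain ⟨r, h1, h2⟩ := h
  choose u v b h3 h4 using h1
  refine ⟨fun k j => Sum.elim (u k) (v k) (e j), b, fun y k => ?_, ?_⟩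
  · have := h3 k y
    simp only at this
    rw [this, e.sum_comp (fun q => Sum.elim (u k) (v k) q * max 0 (Sum.elim y (fun i => -y i) q))]
    simp [Fintype.sum_sum_type]
  · refine le_trans ?_ h2
    rw [nz, ← Finset.sum_add_distrib]
    refine Finset.sum_le_sum fun k _ => ?_
    rw [nz_comp_equiv (Sum.elim (u k) (v k)) e, nz_sum_type]
    exact h4 k

/-- A stack of signed layers can be prepended to a ReLU network that reads the positive and the
negative parts of its output. -/
lemma exists_prepend {κ : Type} [Fintype κ] {F : (Fin p → ℝ) → κ → ℝ} {d c : ℕ} (h : NetFn F d c) :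
    ∀ {l k : ℕ} (e : Fin l ≃ κ ⊕ κ) (Ψ : ReLUNet l k), ∃ Φ : ReLUNet p k,
      (∀ x, Φ.realize x = Ψ.realize fun j => max 0 (Sum.elim (F x) (fun i => -F x i) (e j))) ∧
      Φ.depth = d + Ψ.depth ∧ Φ.numParams ≤ 2 * c + Ψ.numParams := by
  induction h with
  | affine W b hc =>
    intro l k e Ψ
    obtain ⟨Φ, h1, h2, h3⟩ := exists_layer e W b Ψ
    exact ⟨Φ, h1, by omega, by omega⟩
  | @layer ι κ _ _ F d c c' T hF hT ih =>
    intro l k e Ψ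
    have e' := (Fintype.equivFin (ι ⊕ ι)).symm
    obtain ⟨W, b, h1, h2⟩ := hT.exists_affine e'
    obtain ⟨Ψ', h3, h4, h5⟩ := exists_layer e W b Ψ
    obtain ⟨Φ, h6, h7, h8⟩ := ih e' Ψ'
    refine ⟨Φ, fun x => ?_, by omega, by omega⟩
    beta_reduce
    rw [h6, h3, show T (F x) = _ from funext (h1 (F x))]

/-- Each signal of a stack of signed layers is carried by two ReLU neurons, its positive and its
negative part; this doubles the number of parameters and keeps the depth. -/
theorem exists_reluNet {k : ℕ} {F : (Fin p → ℝ) → Fin k → ℝ} {d c : ℕ} (h : NetFn F d c) :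
    ∃ Φ : ReLUNet p k, (∀ x, Φ.realize x = F x) ∧ Φ.depth = d ∧ Φ.numParams ≤ 2 * c := by
  cases h with
  | affine W b hc =>
    refine ⟨.output W b, fun x => rfl, rfl, ?_⟩
    exact (ReLUNet.nnz_eq W b).le.trans (hc.trans (by omega))
  | @layer ι _ _ _ F d c c' T hF hT =>
    have e := (Fintype.equivFin (ι ⊕ ι)).symm
    obtain ⟨W, b, h1, h2⟩ := hT.exists_affine e
    obtain ⟨Φ, h3, h4, h5⟩ := hF.exists_prepend e (.output W b)
    refine ⟨Φ, fun x => ?_, h4, ?_⟩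
    · rw [h3]
      ext k
      exact (h1 (F x) k).symm
    · have h6 : (ReLUNet.output W b).numParams ≤ c' := (ReLUNet.nnz_eq W b).le.trans h2
      omega

end NetFn

/-! ### Approximate multiplication -/

/-- The tent map on `[-1, 1]`. -/
noncomputable def tent (w : ℝ) : ℝ := 1 - 2 * |w|

/-- The partial sum `∑_{s < m} 4⁻ˢ (|tentˢ a| - |tentˢ b|)`, which approximates `a ^ 2 - b ^ 2`. -/
noncomputable def tentSum (m : ℕ) (a b : ℝ) : ℝ :=
  ∑ s ∈ Finset.range m, (|tent^[s] a| - |tent^[s] b|) / 4 ^ s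

/-- The approximate product, obtained from
`x * y = Z ^ 2 * (((x + y) / (2 * Z)) ^ 2 - ((x - y) / (2 * Z)) ^ 2)`. -/
noncomputable def mulApprox (Z : ℝ) (m : ℕ) (x y : ℝ) : ℝ :=
  Z ^ 2 * tentSum m ((x + y) / (2 * Z)) ((x - y) / (2 * Z))

lemma abs_tent_le {w : ℝ} (hw : |w| ≤ 1) : |tent w| ≤ 1 := by
  unfold tent
  rw [abs_le]
  constructor <;> linarith [abs_nonneg w]

lemma abs_tent_iterate_le {w : ℝ} (hw : |w| ≤ 1) (m : ℕ) : |tent^[m] w| ≤ 1 := by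
  induction m with
  | zero => simpa using hw
  | succ m ih => rw [Function.iterate_succ_apply']; exact abs_tent_le ih

/-- The identity `w ^ 2 = |w| - 1 / 4 + (tent w) ^ 2 / 4`, iterated `m` times. -/
lemma sq_sub_sq_eq_tentSum (m : ℕ) (a b : ℝ) :
    a ^ 2 - b ^ 2 = tentSum m a b + ((tent^[m] a) ^ 2 - (tent^[m] b) ^ 2) / 4 ^ m := by
  induction m with
  | zero => simp [tentSum]
  | succ m ih =>
    rw [ih, tentSum, tentSum, Finset.sum_range_succ, Function.iterate_succ_apply',
      Function.iterate_succ_apply']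
    have key : ∀ w : ℝ, w ^ 2 = |w| - 1 / 4 + tent w ^ 2 / 4 := fun w => by
      rw [tent, ← sq_abs w]; ring
    rw [key (tent^[m] a), key (tent^[m] b)]
    field_simp
    ring

lemma abs_mulApprox_sub_le {Z : ℝ} (hZ : 0 < Z) (m : ℕ) {x y : ℝ} (hx : |x| ≤ Z) (hy : |y| ≤ Z) :
    |mulApprox Z m x y - x * y| ≤ Z ^ 2 / 4 ^ m := by
  have bound : ∀ w : ℝ, |w| ≤ 2 * Z → |w / (2 * Z)| ≤ 1 := fun w hw => by
    rw [abs_div, abs_of_pos (by linarith : 0 < 2 * Z)]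
    exact div_le_one_of_le₀ hw (by linarith)
  rw [abs_le] at hx hy
  have ha := abs_tent_iterate_le (bound (x + y) (abs_le.2 ⟨by linarith, by linarith⟩)) m
  have hb := abs_tent_iterate_le (bound (x - y) (abs_le.2 ⟨by linarith, by linarith⟩)) m
  have h := sq_sub_sq_eq_tentSum m ((x + y) / (2 * Z)) ((x - y) / (2 * Z))
  set u := tent^[m] ((x + y) / (2 * Z))
  set v := tent^[m] ((x - y) / (2 * Z))
  have hxy : x * y = Z ^ 2 * (((x + y) / (2 * Z)) ^ 2 - ((x - y) / (2 * Z)) ^ 2) := by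
    field_simp
    ring
  have huv : |u ^ 2 - v ^ 2| ≤ 1 := by
    have hu : u ^ 2 ≤ 1 := (sq_le_one_iff_abs_le_one u).2 ha
    have hv : v ^ 2 ≤ 1 := (sq_le_one_iff_abs_le_one v).2 hb
    rw [abs_le]
    constructor <;> nlinarith [sq_nonneg u, sq_nonneg v]
  rw [mulApprox, hxy, h, show ∀ t e : ℝ, Z ^ 2 * t - Z ^ 2 * (t + e) = -(Z ^ 2 * e) by intros; ring,
    abs_neg, abs_mul, abs_div, abs_of_pos (by positivity : (0 : ℝ) < Z ^ 2),
    abs_of_pos (by positivity : (0 : ℝ) < 4 ^ m), mul_div_assoc']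
  gcongr
  exact mul_le_of_le_one_right (by positivity) huv

/-! ### Matrix products of networks -/

namespace NetFn

variable {p : ℕ} {ι κ S ρ : Type} [Fintype ι] [Fintype κ] [Fintype S] [Fintype ρ]

/-- Approximate scalar products of selected input coordinates, one for each `k`. The coordinates
selected by `pass` are handed on unchanged. -/
lemma bilinear {F : (Fin p → ℝ) → ι → ℝ} {d c : ℕ} (hF : NetFn F d c) (l r : κ → S → ι)
    (pass : ρ → ι) (Z : ℝ) (m : ℕ) :
    NetFn (fun x => Sum.elim (fun k => ∑ s, mulApprox Z m (F x (l k s)) (F x (r k s)))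
        fun q => F x (pass q))
      (d + (m + 2))
      (c + (Fintype.card κ * Fintype.card S * (12 * m + 10) +
        Fintype.card ρ * (2 * (m + 2)))) := by
  -- The signals are the two tent orbits and the partial sum of each product.
  let stage (m : ℕ) : (Fin p → ℝ) → ((κ × S) × Fin 3) ⊕ ρ → ℝ := fun x =>
    Sum.elim (fun j =>
      ![tent^[m] ((F x (l j.1.1 j.1.2) + F x (r j.1.1 j.1.2)) / (2 * Z)),
        tent^[m] ((F x (l j.1.1 j.1.2) - F x (r j.1.1 j.1.2)) / (2 * Z)),
        tentSum m ((F x (l j.1.1 j.1.2) + F x (r j.1.1 j.1.2)) / (2 * Z))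
          ((F x (l j.1.1 j.1.2) - F x (r j.1.1 j.1.2)) / (2 * Z))] j.2)
      fun q => F x (pass q)
  -- A layer into the space of these signals is described by three kinds of rows.
  have row3 : ∀ {ι' : Type} [Fintype ι'] {T : (ι' → ℝ) → (κ × S) × Fin 3 → ℝ} {c₀ c₁ c₂ : ℕ},
      (∀ j, IsRow (fun x => T x (j, 0)) c₀) → (∀ j, IsRow (fun x => T x (j, 1)) c₁) →
      (∀ j, IsRow (fun x => T x (j, 2)) c₂) →
      IsLayer T (Fintype.card κ * Fintype.card S * (c₀ + c₁ + c₂)) := by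
    intro ι' _ T c₀ c₁ c₂ h₀ h₁ h₂
    refine ⟨fun j => ![c₀, c₁, c₂] j.2, ?_, ?_⟩
    · rintro ⟨j, i⟩
      fin_cases i
      exacts [h₀ j, h₁ j, h₂ j]
    · simp [Fintype.sum_prod_type, Fin.sum_univ_three]
  have h₀ : NetFn (stage 0) (d + 1)
      (c + (Fintype.card κ * Fintype.card S * 8 + Fintype.card ρ * 2)) := by
    have := layer hF ((row3 (T := fun x j => ![(x (l j.1.1 j.1.2) + x (r j.1.1 j.1.2)) / (2 * Z),
        (x (l j.1.1 j.1.2) - x (r j.1.1 j.1.2)) / (2 * Z), 0] j.2) (c₀ := 4) (c₁ := 4) (c₂ := 0)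
      (fun j => ?_) (fun j => ?_) (fun j => ?_)).elim
        (IsLayer.of_rows (T := fun x q => x (pass q)) fun q => IsRow.coord (pass q)))
    · simpa [stage, tentSum] using this
    · simpa [div_eq_inv_mul] using
        ((IsRow.coord (l j.1 j.2)).add (IsRow.coord (r j.1 j.2))).smul (2 * Z)⁻¹
    · simpa [div_eq_inv_mul, sub_eq_add_neg] using
        ((IsRow.coord (l j.1 j.2)).add ((IsRow.coord (r j.1 j.2)).smul (-1))).smul (2 * Z)⁻¹
    · simpa using IsRow.zero
  have hs : ∀ m, NetFn (stage m) (d + (m + 1))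
      (c + (Fintype.card κ * Fintype.card S * (12 * m + 8) +
        Fintype.card ρ * (2 * (m + 1)))) := by
    intro m
    induction m with
    | zero => simpa using h₀
    | succ m ih =>
      have := layer ih ((row3 (T := fun x j => ![1 - 2 * |x (Sum.inl (j.1, 0))|,
        1 - 2 * |x (Sum.inl (j.1, 1))|, x (Sum.inl (j.1, 2)) +
          (|x (Sum.inl (j.1, 0))| - |x (Sum.inl (j.1, 1))|) / 4 ^ m] j.2)
        (c₀ := 3) (c₁ := 3) (c₂ := 6)
        (fun j => ?_) (fun j => ?_) (fun j => ?_)).elim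
          (IsLayer.of_rows (T := fun (x : ((κ × S) × Fin 3) ⊕ ρ → ℝ) q => x (Sum.inr q))
            fun q => IsRow.coord (Sum.inr q)))
      · convert this using 1
        · ext x (⟨j, i⟩ | q)
          · fin_cases i <;> simp [stage, Function.iterate_succ_apply', tent, tentSum,
              Finset.sum_range_succ]
          · rfl
        · rfl
        · ring
      · simpa [sub_eq_add_neg] using (IsRow.const 1).add ((IsRow.abs (Sum.inl (j, 0))).smul (-2))
      · simpa [sub_eq_add_neg] using (IsRow.const 1).add ((IsRow.abs (Sum.inl (j, 1))).smul (-2))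
      · simpa [sub_eq_add_neg, div_eq_inv_mul] using (IsRow.coord (Sum.inl (j, 2))).add
          (((IsRow.abs (Sum.inl (j, 0))).add ((IsRow.abs (Sum.inl (j, 1))).smul (-1))).smul
            (4 ^ m)⁻¹)
  have := layer (hs m) ((IsLayer.of_rows (T := fun (x : ((κ × S) × Fin 3) ⊕ ρ → ℝ) k =>
      Z ^ 2 * ∑ s, x (Sum.inl ((k, s), 2))) fun k => (IsRow.sum Finset.univ fun s =>
        IsRow.coord (Sum.inl ((k, s), 2))).smul (Z ^ 2)).elim
    (IsLayer.of_rows (T := fun (x : ((κ × S) × Fin 3) ⊕ ρ → ℝ) q => x (Sum.inr q))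
      fun q => IsRow.coord (Sum.inr q)))
  convert this using 1
  · ext x (k | q)
    · simp [stage, mulApprox, Finset.mul_sum]
    · rfl
  · rfl
  · simp only [Finset.sum_const, Finset.card_univ, smul_eq_mul]
    ring

end NetFn

/-- The matrix product with approximate multiplications. -/
noncomputable def matMulApprox {k l n : ℕ} (Z : ℝ) (m : ℕ) (A : Matrix (Fin k) (Fin l) ℝ)
    (B : Matrix (Fin l) (Fin n) ℝ) : Matrix (Fin k) (Fin n) ℝ :=
  Matrix.of fun i j => ∑ s, mulApprox Z m (A i s) (B s j)

/-- The product of a matrix and a vector with approximate multiplications. -/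
noncomputable def mulVecApprox {k l : ℕ} (Z : ℝ) (m : ℕ) (A : Matrix (Fin k) (Fin l) ℝ)
    (v : Fin l → ℝ) : Fin k → ℝ :=
  fun i => ∑ s, mulApprox Z m (A i s) (v s)

/-- One step of the Newton iteration `X ↦ X (2 - A X)` for the inverse of `A`, with approximate
multiplications. -/
noncomputable def newtonApprox {n : ℕ} (Z : ℝ) (m : ℕ) (A X : Matrix (Fin n) (Fin n) ℝ) :
    Matrix (Fin n) (Fin n) ℝ :=
  matMulApprox Z m X (2 - matMulApprox Z m A X)

/-- The entries of a matrix as a vector. -/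
def flat {k n : ℕ} (A : Matrix (Fin k) (Fin n) ℝ) : Fin k × Fin n → ℝ := fun q => A q.1 q.2

namespace NetFn

variable {p n N : ℕ}

/-- One Newton step for the state `(X, y, A)`; the vector `y` is only carried along. -/
lemma newton {A X : (Fin p → ℝ) → Matrix (Fin n) (Fin n) ℝ} {y : (Fin p → ℝ) → Fin n → ℝ}
    {d c : ℕ}
    (h : NetFn (fun x => Sum.elim (flat (X x)) (Sum.elim (y x) (flat (A x)))) d c)
    (Z : ℝ) (m : ℕ) :
    NetFn (fun x => Sum.elim (flat (newtonApprox Z m (A x) (X x)))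
        (Sum.elim (y x) (flat (A x))))
      (d + (2 * m + 5)) (c + n ^ 3 * (50 * (m + 1))) := by
  have h₁ := h.bilinear (κ := Fin n × Fin n) (fun k s => .inr (.inr (k.1, s)))
    (fun k s => .inl (s, k.2)) id Z m
  have h₂ := layer h₁ ((IsLayer.of_rows (c := 3)
    (T := fun (x : (Fin n × Fin n) ⊕ ((Fin n × Fin n) ⊕ (Fin n ⊕ Fin n × Fin n)) → ℝ) k =>
      (2 : Matrix (Fin n) (Fin n) ℝ) k.1 k.2 - x (Sum.inl k)) fun k => by
        simpa [sub_eq_add_neg] using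
          (IsRow.const _).add ((IsRow.coord (Sum.inl k)).smul (-1))).elim
    (IsLayer.of_rows (T := fun (x : (Fin n × Fin n) ⊕ ((Fin n × Fin n) ⊕ (Fin n ⊕ Fin n × Fin n))
      → ℝ) q => x (Sum.inr q)) fun q => IsRow.coord (Sum.inr q)))
  have h₃ := h₂.bilinear (κ := Fin n × Fin n) (fun k s => .inr (.inl (k.1, s)))
    (fun k s => .inl (s, k.2)) (fun q => .inr (.inr q)) Z m
  rw [show d + (m + 2) + 1 + (m + 2) = d + (2 * m + 5) by ring] at h₃
  have hc : c + (n * n * n * (12 * m + 10) + (n * n + (n + n * n)) * (2 * (m + 2))) +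
      (n * n * 3 + (n * n + (n + n * n)) * 2) +
      (n * n * n * (12 * m + 10) + (n + n * n) * (2 * (m + 2))) ≤ c + n ^ 3 * (50 * (m + 1)) := by
    have h1 : n ≤ n ^ 3 := Nat.le_self_pow (by norm_num) n
    have h2 : n ^ 2 ≤ n ^ 3 := by
      rcases Nat.eq_zero_or_pos n with rfl | hn
      · simp
      · exact Nat.pow_le_pow_right hn (by norm_num)
    nlinarith [Nat.mul_le_mul_left m h1, Nat.mul_le_mul_left m h2]
  simp only [Fintype.card_prod, Fintype.card_fin, Fintype.card_sum] at h₃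
  convert h₃.mono hc using 1
  ext x (k | k | k) <;> rfl

lemma newton_iterate {A X : (Fin p → ℝ) → Matrix (Fin n) (Fin n) ℝ} {y : (Fin p → ℝ) → Fin n → ℝ}
    {d c : ℕ}
    (h : NetFn (fun x => Sum.elim (flat (X x)) (Sum.elim (y x) (flat (A x)))) d c)
    (Z : ℝ) (m K : ℕ) :
    NetFn (fun x => Sum.elim (flat ((newtonApprox Z m (A x))^[K] (X x)))
        (Sum.elim (y x) (flat (A x))))
      (d + K * (2 * m + 5)) (c + K * (n ^ 3 * (50 * (m + 1)))) := by
  induction K with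
  | zero => simpa using h
  | succ K ih =>
    have := ih.newton Z m
    simp only [Function.iterate_succ_apply', add_mul, one_mul]
    convert this using 1 <;> ring

end NetFn

/-! ### Spectral norm estimates -/

section Norms

open scoped Matrix.Norms.L2Operator

lemma norm_toLp_le_of_abs_le {k : ℕ} {v : Fin k → ℝ} {e : ℝ} (h : ∀ i, |v i| ≤ e) :
    ‖WithLp.toLp 2 v‖ ≤ k * e := by
  rcases Nat.eq_zero_or_pos k with rfl | hk
  · simp [EuclideanSpace.norm_eq]
  have he : 0 ≤ e := (abs_nonneg _).trans (h ⟨0, hk⟩)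
  have hk' : (1 : ℝ) ≤ k := by exact_mod_cast hk
  rw [EuclideanSpace.norm_eq]
  refine Real.sqrt_le_iff.2 ⟨by positivity, ?_⟩
  calc ∑ i, ‖v i‖ ^ 2 ≤ ∑ _i : Fin k, e ^ 2 := by
        refine Finset.sum_le_sum fun i _ => ?_
        exact pow_le_pow_left₀ (norm_nonneg _) (h i) 2
    _ = k * e ^ 2 := by simp
    _ ≤ (k * e) ^ 2 := by
        rw [mul_pow, sq (k : ℝ)]
        gcongr
        exact le_mul_of_one_le_left (by positivity) hk'

lemma abs_apply_le_norm_toLp {k : ℕ} (v : Fin k → ℝ) (i : Fin k) :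
    |v i| ≤ ‖WithLp.toLp 2 v‖ :=
  PiLp.norm_apply_le (WithLp.toLp 2 v) i

lemma norm_toLp_mulVec_le {k l : ℕ} (A : Matrix (Fin k) (Fin l) ℝ) (v : Fin l → ℝ) :
    ‖WithLp.toLp 2 (A.mulVec v)‖ ≤ ‖A‖ * ‖WithLp.toLp 2 v‖ :=
  Matrix.l2_opNorm_mulVec A (WithLp.toLp 2 v)

lemma abs_apply_le_opNorm {k l : ℕ} (A : Matrix (Fin k) (Fin l) ℝ) (i : Fin k) (j : Fin l) :
    |A i j| ≤ ‖A‖ := by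
  have h := (abs_apply_le_norm_toLp _ i).trans (norm_toLp_mulVec_le A (Pi.single j 1))
  have h1 : ‖WithLp.toLp 2 (Pi.single j (1 : ℝ) : Fin l → ℝ)‖ = 1 := by
    simp
  simpa [h1] using h

lemma opNorm_le_of_abs_le {k l : ℕ} {A : Matrix (Fin k) (Fin l) ℝ} {e : ℝ} (he : 0 ≤ e)
    (h : ∀ i j, |A i j| ≤ e) : ‖A‖ ≤ k * l * e := by
  rw [Matrix.l2_opNorm_def]
  refine ContinuousLinearMap.opNorm_le_bound _ (by positivity) fun x => ?_
  have := norm_toLp_le_of_abs_le (v := A.mulVec x) (e := l * e * ‖x‖) fun i => by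
    calc |∑ j, A i j * x j| ≤ ∑ j, |A i j * x j| := Finset.abs_sum_le_sum_abs _ _
      _ ≤ ∑ _j : Fin l, e * ‖x‖ := by
          refine Finset.sum_le_sum fun j _ => ?_
          rw [abs_mul]
          exact mul_le_mul (h i j) (PiLp.norm_apply_le x j) (abs_nonneg _) he
      _ = l * e * ‖x‖ := by simp [mul_assoc]
  calc _ ≤ k * (l * e * ‖x‖) := this
    _ = _ := by ring

lemma norm_transpose {k l : ℕ} (A : Matrix (Fin k) (Fin l) ℝ) : ‖A.transpose‖ = ‖A‖ :=
  Matrix.l2_opNorm_conjTranspose A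

lemma norm_one_le {n : ℕ} : ‖(1 : Matrix (Fin n) (Fin n) ℝ)‖ ≤ 1 := by
  rw [← Matrix.diagonal_one, Matrix.l2_opNorm_diagonal]
  exact (pi_norm_le_iff_of_nonneg zero_le_one).2 fun i => by simp

lemma norm_matMulApprox_sub_le {k l n : ℕ} {Z : ℝ} (hZ : 0 < Z) (m : ℕ)
    {A : Matrix (Fin k) (Fin l) ℝ} {B : Matrix (Fin l) (Fin n) ℝ} (hA : ‖A‖ ≤ Z) (hB : ‖B‖ ≤ Z) :
    ‖matMulApprox Z m A B - A * B‖ ≤ k * n * (l * (Z ^ 2 / 4 ^ m)) := by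
  refine opNorm_le_of_abs_le (by positivity) fun i j => ?_
  rw [Matrix.sub_apply, Matrix.mul_apply, matMulApprox, Matrix.of_apply, ← Finset.sum_sub_distrib]
  refine (Finset.abs_sum_le_sum_abs _ _).trans ?_
  calc _ ≤ ∑ _s : Fin l, Z ^ 2 / 4 ^ m := Finset.sum_le_sum fun s _ =>
        abs_mulApprox_sub_le hZ m ((abs_apply_le_opNorm A i s).trans hA)
          ((abs_apply_le_opNorm B s j).trans hB)
    _ = _ := by simp

lemma norm_mulVecApprox_sub_le {k l : ℕ} {Z : ℝ} (hZ : 0 < Z) (m : ℕ)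
    {A : Matrix (Fin k) (Fin l) ℝ} {v : Fin l → ℝ} (hA : ‖A‖ ≤ Z) (hv : ‖WithLp.toLp 2 v‖ ≤ Z) :
    ‖WithLp.toLp 2 (mulVecApprox Z m A v - A.mulVec v)‖ ≤ k * (l * (Z ^ 2 / 4 ^ m)) := by
  refine norm_toLp_le_of_abs_le fun i => ?_
  rw [Pi.sub_apply, Matrix.mulVec, dotProduct, mulVecApprox, ← Finset.sum_sub_distrib]
  refine (Finset.abs_sum_le_sum_abs _ _).trans ?_
  calc _ ≤ ∑ _s : Fin l, Z ^ 2 / 4 ^ m := Finset.sum_le_sum fun s _ =>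
        abs_mulApprox_sub_le hZ m ((abs_apply_le_opNorm A i s).trans hA)
          ((abs_apply_le_norm_toLp v s).trans hv)
    _ = _ := by simp

/-- By the spectral theorem, the norm of `s - t A` is the largest value of `|s - t λ|` on the
spectrum of `A`. -/
lemma norm_smul_one_sub_smul_le {n : ℕ} {A : Matrix (Fin n) (Fin n) ℝ} (hA : A.IsHermitian)
    {s t e : ℝ} (he : 0 ≤ e) (h : ∀ lam ∈ spectrum ℝ A, |s - t * lam| ≤ e) :
    ‖s • (1 : Matrix (Fin n) (Fin n) ℝ) - t • A‖ ≤ e := by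
  set U := hA.eigenvectorUnitary
  have hU : (U : Matrix (Fin n) (Fin n) ℝ) * star (U : Matrix (Fin n) (Fin n) ℝ) = 1 :=
    Unitary.coe_mul_star_self U
  have hspec : A = (U : Matrix (Fin n) (Fin n) ℝ) * Matrix.diagonal hA.eigenvalues *
      star (U : Matrix (Fin n) (Fin n) ℝ) := by
    simpa [Unitary.conjStarAlgAut_apply] using hA.spectral_theorem
  have key : s • (1 : Matrix (Fin n) (Fin n) ℝ) - t • A = (U : Matrix (Fin n) (Fin n) ℝ) *
      Matrix.diagonal (fun i => s - t * hA.eigenvalues i) *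
        star (U : Matrix (Fin n) (Fin n) ℝ) := by
    have hd : Matrix.diagonal (fun i => s - t * hA.eigenvalues i) =
        s • (1 : Matrix (Fin n) (Fin n) ℝ) - t • Matrix.diagonal hA.eigenvalues := by
      ext i j
      by_cases hij : i = j <;> simp [Matrix.diagonal, hij]
    rw [hd, mul_sub, sub_mul, mul_smul_comm, mul_smul_comm, smul_mul_assoc, smul_mul_assoc, mul_one,
      hU, ← hspec]
  rw [key, ← Unitary.coe_star, CStarRing.norm_mul_coe_unitary, CStarRing.norm_coe_unitary_mul,
    Matrix.l2_opNorm_diagonal]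
  exact (pi_norm_le_iff_of_nonneg he).2 fun i => h _ (hA.eigenvalues_mem_spectrum_real i)

end Norms

/-! ### The Newton iteration with errors -/

section Newton

/-- A residual `1 - A X` of norm at most one bounds `X`, since `A` is invertible with
`‖A⁻¹‖ ≤ t / θ`. -/
lemma norm_le_of_norm_one_sub_mul_le {R : Type*} [NormedRing R] [NormedAlgebra ℝ R]
    (h1 : ‖(1 : R)‖ ≤ 1) {A X : R} {t θ : ℝ} (ht : 0 < t) (hθ : 0 < θ)
    (hA : ‖1 - t • A‖ ≤ 1 - θ) (hX : ‖1 - A * X‖ ≤ 1) : ‖X‖ ≤ 2 * t / θ := by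
  have hAX : ‖A * X‖ ≤ 2 := by
    calc ‖A * X‖ = ‖1 - (1 - A * X)‖ := by rw [sub_sub_cancel]
      _ ≤ ‖(1 : R)‖ + ‖1 - A * X‖ := norm_sub_le _ _
      _ ≤ 2 := by linarith
  have : ‖X‖ ≤ (1 - θ) * ‖X‖ + t * 2 := by
    calc ‖X‖ = ‖(1 - t • A) * X + t • (A * X)‖ := by
          rw [sub_mul, one_mul, smul_mul_assoc, sub_add_cancel]
      _ ≤ ‖(1 - t • A) * X‖ + ‖t • (A * X)‖ := norm_add_le _ _
      _ ≤ ‖1 - t • A‖ * ‖X‖ + t * ‖A * X‖ := by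
          refine add_le_add (norm_mul_le _ _) ?_
          rw [norm_smul, Real.norm_of_nonneg ht.le]
      _ ≤ _ := by gcongr
  rw [le_div_iff₀ hθ]
  linarith

/-- If `Y` and `X'` are `A X` and `X (2 - Y)` up to `δ`, the residual of `X'` is the square of that
of `X` up to a multiple of `δ`. -/
lemma norm_residual_newton_le {R : Type*} [NormedRing R] (h1 : ‖(1 : R)‖ ≤ 1) {A X Y X' : R}
    {δ a r : ℝ} (hA : ‖A‖ ≤ a) (hr : ‖1 - A * X‖ ≤ r) (hr1 : r ≤ 1) (hY : ‖Y - A * X‖ ≤ δ)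
    (hX' : ‖X' - X * (2 - Y)‖ ≤ δ) : ‖1 - A * X'‖ ≤ r ^ 2 + (2 + a) * δ := by
  have hδ : 0 ≤ δ := (norm_nonneg _).trans hY
  have hAX : ‖A * X‖ ≤ 2 := by
    calc ‖A * X‖ = ‖1 - (1 - A * X)‖ := by rw [sub_sub_cancel]
      _ ≤ ‖(1 : R)‖ + ‖1 - A * X‖ := norm_sub_le _ _
      _ ≤ 2 := by linarith
  have key : 1 - A * X' = (1 - A * X) * (1 - A * X) + A * X * (Y - A * X) -
      A * (X' - X * (2 - Y)) := by noncomm_ring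
  rw [key]
  calc _ ≤ ‖(1 - A * X) * (1 - A * X)‖ + ‖A * X * (Y - A * X)‖ + ‖A * (X' - X * (2 - Y))‖ :=
        (norm_sub_le _ _).trans (add_le_add_left (norm_add_le _ _) _)
    _ ≤ ‖1 - A * X‖ * ‖1 - A * X‖ + ‖A * X‖ * ‖Y - A * X‖ + ‖A‖ * ‖X' - X * (2 - Y)‖ := by
        gcongr <;> exact norm_mul_le _ _
    _ ≤ r * r + 2 * δ + a * δ := by
        have := norm_nonneg (1 - A * X)
        have := norm_nonneg A
        gcongr
        all_goals linarith
    _ = _ := by ring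

/-- The induction step for the recursion `r ↦ r ^ 2 + η`: the weight `1 + θ` of the main term `u`
makes room for the error `η`. -/
lemma sq_add_le_of_le {θ η : ℝ} (hθ : 0 < θ) (hθ1 : θ ≤ 1) (hη : 0 ≤ η) (hηθ : η ≤ θ ^ 2 / 8)
    {r u : ℝ} (hr : 0 ≤ r) (hu : r ≤ u / (1 + θ) + 2 * η) :
    r ^ 2 + η ≤ u ^ 2 / (1 + θ) + 2 * η := by
  have h1 : (0 : ℝ) < 1 + θ := by linarith
  have hr2 : r ^ 2 ≤ (u / (1 + θ) + 2 * η) ^ 2 := pow_le_pow_left₀ hr hu 2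
  obtain ⟨w, rfl⟩ : ∃ w, u = w * (1 + θ) := ⟨u / (1 + θ), by field_simp⟩
  rw [mul_div_assoc, div_self h1.ne', mul_one] at hr2
  have e : (w * (1 + θ)) ^ 2 / (1 + θ) = w ^ 2 + θ * w ^ 2 := by field_simp
  rw [e]
  -- Young's inequality splits the mixed term between `θ w ^ 2` and `4 η ^ 2 / θ`.
  have young : 4 * w * η ≤ θ * w ^ 2 + η / 2 := by
    have h2 : 0 ≤ (θ * w - 2 * η) ^ 2 := sq_nonneg _
    have h3 : 4 * η ^ 2 ≤ θ * (η / 2) := by nlinarith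
    have h4 : θ * (4 * w * η) ≤ θ * (θ * w ^ 2 + η / 2) := by nlinarith
    exact le_of_mul_le_mul_left h4 hθ
  have hη1 : η ≤ 1 / 8 := by nlinarith
  have : 4 * η ^ 2 ≤ η / 2 := by nlinarith
  nlinarith

end Newton

section Iteration

open scoped Matrix.Norms.L2Operator

/-- Quadratic convergence of the Newton iteration with approximate multiplications. -/
theorem norm_residual_newtonApprox_iterate_le {n : ℕ} {A : Matrix (Fin n) (Fin n) ℝ}
    {t θ Z a δ : ℝ} {m : ℕ} (ht : 0 < t) (hθ : 0 < θ) (hθ1 : θ ≤ 1)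
    (hA : ‖1 - t • A‖ ≤ 1 - θ) (ha : ‖A‖ ≤ a) (haZ : a ≤ Z) (htZ : 2 * t / θ ≤ Z) (hZ : 3 ≤ Z)
    (hδ : n * n * (n * (Z ^ 2 / 4 ^ m)) ≤ δ) (hδ1 : δ ≤ 1) (hδθ : (2 + a) * δ ≤ θ ^ 2 / 8)
    (K : ℕ) :
    ‖1 - A * (newtonApprox Z m A)^[K] (t • 1)‖ ≤ 1 ∧
      ‖1 - A * (newtonApprox Z m A)^[K] (t • 1)‖ ≤
        (1 - θ ^ 2) ^ 2 ^ K + 2 * ((2 + a) * δ) := by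
  have hZ0 : 0 < Z := by linarith
  have ha0 : 0 ≤ a := (norm_nonneg A).trans ha
  have hδ0 : 0 ≤ δ := le_trans (by positivity) hδ
  have hu0 : 0 ≤ 1 - θ ^ 2 := by nlinarith
  have hu1 : 1 - θ ^ 2 ≤ 1 := by nlinarith
  have h1θ : 0 < 1 + θ := by linarith
  have hdiv : (1 - θ ^ 2) / (1 + θ) = 1 - θ := by field_simp; ring
  -- The bound on the residual implies that it is at most one.
  have le_one : ∀ k : ℕ, (1 - θ ^ 2) ^ 2 ^ k / (1 + θ) + 2 * ((2 + a) * δ) ≤ 1 := fun k => by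
    have h : (1 - θ ^ 2) ^ 2 ^ k ≤ 1 - θ ^ 2 := pow_le_of_le_one hu0 hu1 (by positivity)
    have := div_le_div_of_nonneg_right h h1θ.le
    rw [hdiv] at this
    nlinarith
  suffices h : ‖1 - A * (newtonApprox Z m A)^[K] (t • 1)‖ ≤
      (1 - θ ^ 2) ^ 2 ^ K / (1 + θ) + 2 * ((2 + a) * δ) by
    refine ⟨h.trans (le_one K), h.trans ?_⟩
    gcongr
    exact div_le_self (by positivity) (by linarith)
  induction K with
  | zero =>
    simp only [Function.iterate_zero, id, pow_zero, pow_one, mul_smul_comm, mul_one, hdiv]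
    nlinarith [mul_nonneg (by linarith : 0 ≤ 2 + a) hδ0]
  | succ K ih =>
    rw [Function.iterate_succ_apply']
    set X := (newtonApprox Z m A)^[K] (t • 1)
    have hX1 := ih.trans (le_one K)
    have hX := (norm_le_of_norm_one_sub_mul_le norm_one_le ht hθ hA hX1).trans htZ
    have hY := (norm_matMulApprox_sub_le hZ0 m (ha.trans haZ) hX).trans hδ
    have h2Y : ‖2 - matMulApprox Z m A X‖ ≤ Z := by
      have e : 2 - matMulApprox Z m A X =
          1 + (1 - A * X) - (matMulApprox Z m A X - A * X) := by
        rw [← one_add_one_eq_two]; abel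
      rw [e]
      refine (norm_sub_le _ _).trans ?_
      have := norm_add_le 1 (1 - A * X)
      have := norm_one_le (n := n)
      linarith
    have hX' := (norm_matMulApprox_sub_le hZ0 m hX h2Y).trans hδ
    have := norm_residual_newton_le (X' := newtonApprox Z m A X) norm_one_le ha le_rfl hX1 hY hX'
    refine this.trans ?_
    rw [pow_succ 2 K, pow_mul]
    exact sq_add_le_of_le hθ hθ1 (by positivity) hδθ (norm_nonneg _) ih

end Iteration

/-! ### Perturbation of the least squares problem -/

section Perturbation

open scoped Matrix.Norms.L2Operator
open PODDNN

variable {N n : ℕ} {α β γ ε : ℝ}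

lemma norm_one_sub_gram_le {B : Matrix (Fin N) (Fin n) ℝ} (hβ : 0 < β) (hαβ : β < α)
    (hspec : spectrum ℝ (B.transpose * B) ⊆ Set.Icc (β ^ 2) (α ^ 2)) :
    ‖1 - (α ^ 2)⁻¹ • (B.transpose * B)‖ ≤ 1 - β ^ 2 / α ^ 2 := by
  have hα : 0 < α := hβ.trans hαβ
  have hA : (B.transpose * B).IsHermitian := Matrix.isHermitian_conjTranspose_mul_self B
  have h1 : β ^ 2 / α ^ 2 ≤ 1 := div_le_one_of_le₀ (by gcongr) (by positivity)
  have := norm_smul_one_sub_smul_le hA (s := 1) (t := (α ^ 2)⁻¹) (e := 1 - β ^ 2 / α ^ 2)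
    (by linarith) fun lam hlam => by
      obtain ⟨h2, h3⟩ := hspec hlam
      have h4 : β ^ 2 / α ^ 2 ≤ (α ^ 2)⁻¹ * lam := by
        rw [div_eq_inv_mul]; gcongr
      have h5 : (α ^ 2)⁻¹ * lam ≤ 1 := by
        rw [inv_mul_le_iff₀ (by positivity)]; linarith
      rw [abs_of_nonneg (by linarith)]
      linarith
  simpa using this

lemma norm_le_of_spectrum_gram {B : Matrix (Fin N) (Fin n) ℝ} (hα : 0 < α)
    (hspec : spectrum ℝ (B.transpose * B) ⊆ Set.Icc (β ^ 2) (α ^ 2)) : ‖B‖ ≤ α := by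
  have hA : (B.transpose * B).IsHermitian := Matrix.isHermitian_conjTranspose_mul_self B
  have := norm_smul_one_sub_smul_le hA (s := 0) (t := -1) (e := α ^ 2) (by positivity)
    fun lam hlam => by
      obtain ⟨h2, h3⟩ := hspec hlam
      rw [abs_of_nonneg (by nlinarith [sq_nonneg β])]
      linarith
  have h2 : ‖B.transpose * B‖ = ‖B‖ * ‖B‖ := Matrix.l2_opNorm_conjTranspose_mul_self B
  simp only [zero_smul, neg_smul, one_smul, zero_sub, neg_neg, h2] at this
  exact abs_le_of_sq_le_sq' (by nlinarith) hα.le |>.2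

/-- The least squares coefficients solve the normal equations. -/
lemma gram_mulVec_leastSquares {B : Matrix (Fin N) (Fin n) ℝ} (hβ : 0 < β)
    (hspec : spectrum ℝ (B.transpose * B) ⊆ Set.Icc (β ^ 2) (α ^ 2)) (r : Fin N → ℝ) :
    (B.transpose * B).mulVec (leastSquares B r) = B.transpose.mulVec r := by
  have hunit : IsUnit (B.transpose * B) := by
    rw [← spectrum.zero_notMem_iff ℝ]
    intro h
    have := (hspec h).1
    nlinarith [pow_pos hβ 2]
  rw [leastSquares, Matrix.mulVec_mulVec, ← Matrix.mul_assoc,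
    Matrix.mul_nonsing_inv _ ((Matrix.isUnit_iff_isUnit_det _).1 hunit), Matrix.one_mul]

/-- A lower bound of `A` from the spectral gap of `1 - t A`. -/
lemma mul_norm_le_norm_mulVec {A : Matrix (Fin n) (Fin n) ℝ} {t θ : ℝ} (ht : 0 ≤ t)
    (hA : ‖1 - t • A‖ ≤ 1 - θ) (z : Fin n → ℝ) :
    θ * ‖WithLp.toLp 2 z‖ ≤ t * ‖WithLp.toLp 2 (A.mulVec z)‖ := by
  have e : WithLp.toLp 2 z = WithLp.toLp 2 ((1 - t • A).mulVec z) +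
      t • WithLp.toLp 2 (A.mulVec z) := by
    rw [← WithLp.toLp_smul, ← WithLp.toLp_add, Matrix.sub_mulVec, Matrix.one_mulVec,
      Matrix.smul_mulVec, sub_add_cancel]
  have h := norm_add_le (WithLp.toLp 2 ((1 - t • A).mulVec z)) (t • WithLp.toLp 2 (A.mulVec z))
  rw [← e, norm_smul, Real.norm_of_nonneg ht] at h
  have h2 := (norm_toLp_mulVec_le (1 - t • A) z).trans
    (mul_le_mul_of_nonneg_right hA (norm_nonneg _))
  linarith

lemma norm_gram_sub_gram_le {B B' : Matrix (Fin N) (Fin n) ℝ} {η : ℝ} (hB : ‖B‖ ≤ α)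
    (hB' : ‖B - B'‖ ≤ η) :
    ‖B'.transpose * B' - B.transpose * B‖ ≤ 2 * α * η + η ^ 2 := by
  have hη : 0 ≤ η := (norm_nonneg _).trans hB'
  have hα : 0 ≤ α := (norm_nonneg _).trans hB
  have e : B'.transpose * B' - B.transpose * B = (B - B').transpose * (B - B') -
      (B.transpose * (B - B') + (B - B').transpose * B) := by
    simp only [Matrix.transpose_sub, Matrix.sub_mul, Matrix.mul_sub]
    abel
  rw [e]
  calc _ ≤ ‖(B - B').transpose‖ * ‖B - B'‖ +
        (‖B.transpose‖ * ‖B - B'‖ + ‖(B - B').transpose‖ * ‖B‖) :=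
        (norm_sub_le _ _).trans (add_le_add (Matrix.l2_opNorm_mul _ _) ((norm_add_le _ _).trans
          (add_le_add (Matrix.l2_opNorm_mul _ _) (Matrix.l2_opNorm_mul _ _))))
    _ ≤ η * η + (α * η + η * α) := by
        rw [norm_transpose, norm_transpose]
        gcongr
    _ = _ := by ring

lemma norm_transpose_mulVec_sub_le {B B' : Matrix (Fin N) (Fin n) ℝ} {r r' : Fin N → ℝ} {η ζ : ℝ}
    (hB : ‖B‖ ≤ α) (hB' : ‖B - B'‖ ≤ η) (hr : ‖WithLp.toLp 2 r‖ ≤ γ)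
    (hr' : ‖WithLp.toLp 2 (r - r')‖ ≤ ζ) :
    ‖WithLp.toLp 2 (B.transpose.mulVec r - B'.transpose.mulVec r')‖ ≤ α * ζ + η * γ + η * ζ := by
  have hη : 0 ≤ η := (norm_nonneg _).trans hB'
  have hα : 0 ≤ α := (norm_nonneg _).trans hB
  have e : B.transpose.mulVec r - B'.transpose.mulVec r' = B.transpose.mulVec (r - r') +
      ((B - B').transpose.mulVec r - (B - B').transpose.mulVec (r - r')) := by
    simp only [Matrix.transpose_sub, Matrix.sub_mulVec, Matrix.mulVec_sub]
    abel
  rw [e, WithLp.toLp_add, WithLp.toLp_sub]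
  calc _ ≤ ‖B.transpose‖ * ‖WithLp.toLp 2 (r - r')‖ + (‖(B - B').transpose‖ * ‖WithLp.toLp 2 r‖ +
        ‖(B - B').transpose‖ * ‖WithLp.toLp 2 (r - r')‖) :=
        (norm_add_le _ _).trans (add_le_add (norm_toLp_mulVec_le _ _) ((norm_sub_le _ _).trans
          (add_le_add (norm_toLp_mulVec_le _ _) (norm_toLp_mulVec_le _ _))))
    _ ≤ α * ζ + (η * γ + η * ζ) := by
        rw [norm_transpose, norm_transpose]
        gcongr
    _ = _ := by ring

end Perturbation

/-! ### The approximate least squares solution -/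

namespace PODDNN

section Tolerances

variable {α β γ ε : ℝ}

lemma tol₁_pos (hα : 0 < α) (hβ : 0 < β) (hγ : 0 < γ) (hε : 0 < ε) : 0 < tol₁ α β γ ε := by
  unfold tol₁; positivity

lemma tol₂_pos (hα : 0 < α) (hβ : 0 < β) (hγ : 0 < γ) (hε : 0 < ε) : 0 < tol₂ α β γ ε := by
  unfold tol₂; positivity

lemma tol₃_pos (hα : 0 < α) (hβ : 0 < β) (hγ : 0 < γ) (hε : 0 < ε) : 0 < tol₃ α β γ ε := by
  unfold tol₃; positivity

lemma tol₁_le_left : tol₁ α β γ ε ≤ ε * β ^ 2 / (12 * γ) :=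
  (min_le_left _ _).trans (min_le_left _ _)

lemma tol₁_le_sqrt : tol₁ α β γ ε ≤ β * √ε / 4 := (min_le_left _ _).trans (min_le_right _ _)

lemma tol₁_le_norm : tol₁ α β γ ε ≤ α / 4 := (min_le_right _ _).trans (min_le_left _ _)

lemma tol₂_le_left : tol₂ α β γ ε ≤ ε * β ^ 2 / (12 * α) :=
  (min_le_left _ _).trans (min_le_left _ _)

lemma tol₂_le_sqrt : tol₂ α β γ ε ≤ β * √ε / 4 := (min_le_left _ _).trans (min_le_right _ _)

lemma tol₂_le_norm : tol₂ α β γ ε ≤ γ / 4 := (min_le_right _ _).trans (min_le_left _ _)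

lemma tol₃_le_left : tol₃ α β γ ε ≤ ε * β ^ 4 / (144 * α ^ 2 * γ) :=
  (min_le_left _ _).trans (min_le_left _ _)

lemma tol₃_le_gap : tol₃ α β γ ε ≤ β ^ 2 / (12 * α) := (min_le_right _ _).trans (min_le_left _ _)

/-- The perturbation of the right-hand side of the normal equations. -/
lemma rhs_tolerance_le (hα : 0 < α) (hβ : 0 < β) (hγ : 0 < γ) (hε : 0 < ε) :
    α * tol₂ α β γ ε + tol₁ α β γ ε * γ + tol₁ α β γ ε * tol₂ α β γ ε ≤ 11 / 48 * (ε * β ^ 2) := by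
  have h1 : tol₁ α β γ ε * γ ≤ ε * β ^ 2 / 12 := by
    calc _ ≤ ε * β ^ 2 / (12 * γ) * γ := by gcongr; exact tol₁_le_left
      _ = _ := by field_simp
  have h2 : α * tol₂ α β γ ε ≤ ε * β ^ 2 / 12 := by
    calc _ ≤ α * (ε * β ^ 2 / (12 * α)) := by gcongr; exact tol₂_le_left
      _ = _ := by field_simp
  have h3 : tol₁ α β γ ε * tol₂ α β γ ε ≤ β ^ 2 * ε / 16 := by
    calc _ ≤ (β * √ε / 4) * (β * √ε / 4) :=
          mul_le_mul tol₁_le_sqrt tol₂_le_sqrt (tol₂_pos hα hβ hγ hε).le (by positivity)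
      _ = β ^ 2 * (√ε * √ε) / 16 := by ring
      _ = _ := by rw [Real.mul_self_sqrt hε.le]
  linarith

/-- The perturbation of the Gram matrix. -/
lemma gram_tolerance_le (hβ : 0 < β) (hαβ : β < α) (hγ : 0 < γ) (hε : 0 < ε) :
    2 * α * tol₃ α β γ ε + tol₃ α β γ ε ^ 2 ≤ 25 / 1728 * (ε * β ^ 4 / (α * γ)) ∧
      2 * α * tol₃ α β γ ε + tol₃ α β γ ε ^ 2 ≤ 25 / 144 * β ^ 2 := by
  have hα : 0 < α := hβ.trans hαβ
  have h0 := tol₃_pos hα hβ hγ hε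
  have h1 : tol₃ α β γ ε ≤ α / 12 := by
    refine tol₃_le_gap.trans ?_
    rw [div_le_div_iff₀ (by positivity) (by positivity)]
    nlinarith
  have h2 : 2 * α * tol₃ α β γ ε + tol₃ α β γ ε ^ 2 ≤ 25 / 12 * α * tol₃ α β γ ε := by nlinarith
  refine ⟨h2.trans ?_, h2.trans ?_⟩
  · calc _ ≤ 25 / 12 * α * (ε * β ^ 4 / (144 * α ^ 2 * γ)) := by gcongr; exact tol₃_le_left
      _ = _ := by field_simp; norm_num
  · calc _ ≤ 25 / 12 * α * (β ^ 2 / (12 * α)) := by gcongr; exact tol₃_le_gap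
      _ = _ := by field_simp; norm_num

end Tolerances

/-- The gap `β ^ 2 / (2 * α ^ 2)` that remains of the spectral gap of `1 - α⁻² Bᵀ B` after a
perturbation. -/
noncomputable def gap (α β : ℝ) : ℝ := β ^ 2 / (2 * α ^ 2)

/-- Conditions on the arithmetic. All matrices and vectors that enter a multiplication have norm at
most `Z`: the approximations of `B` and `r`, the Gram matrix, its approximate inverses and the
right-hand side of the normal equations. The arithmetic errors `κ * ε` are negligible compared with
the errors that the tolerances allow, and do not disturb the convergence of the Newton iteration. -/
structure IsPrecision (α β γ Z κ : ℝ) : Prop where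
  three_le : 3 ≤ Z
  matrix_le : 2 * α ≤ Z
  data_le : 2 * γ ≤ Z
  gram_le : 2 * α ^ 2 ≤ Z
  inverse_le : 4 / β ^ 2 ≤ Z
  rhs_le : 2 * (α * γ) ≤ Z
  pos : 0 < κ
  le_quarter : κ ≤ 1 / 4
  le_rhs : κ ≤ α * γ / 4
  le_gram : κ ≤ β ^ 4 / (1728 * (α * γ))
  le_gap : κ ≤ β ^ 2 / 16
  newton_le : (2 + 2 * α ^ 2) * κ ≤ gap α β ^ 2 / 8
  residual_le : κ * (1 + 2 * (α * γ) * (5 + 4 * α ^ 2)) ≤ β ^ 2 / 4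

lemma exists_isPrecision {α β γ : ℝ} (hα : 0 < α) (hβ : 0 < β) (hγ : 0 < γ) :
    ∃ Z κ, IsPrecision α β γ Z κ := by
  have hg : 0 < gap α β := by unfold gap; positivity
  have hα2 : 0 < α ^ 2 := by positivity
  have hβ2 : 0 < 4 / β ^ 2 := by positivity
  have hαγ : 0 < α * γ := by positivity
  have hu : 0 < 2 + 2 * α ^ 2 := by positivity
  have hv : 0 < 1 + 2 * (α * γ) * (5 + 4 * α ^ 2) := by positivity
  have hs : ∀ q ∈ ({1 / 4, α * γ / 4, β ^ 4 / (1728 * (α * γ)), β ^ 2 / 16,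
      gap α β ^ 2 / 8 / (2 + 2 * α ^ 2),
      β ^ 2 / 4 / (1 + 2 * (α * γ) * (5 + 4 * α ^ 2))} : Finset ℝ), 0 < q := by
    simp only [Finset.mem_insert, Finset.mem_singleton]
    rintro q (rfl | rfl | rfl | rfl | rfl | rfl) <;> positivity
  obtain ⟨κ, hκ0, hκ⟩ : ∃ κ : ℝ, 0 < κ ∧ ∀ q ∈ ({1 / 4, α * γ / 4, β ^ 4 / (1728 * (α * γ)),
      β ^ 2 / 16, gap α β ^ 2 / 8 / (2 + 2 * α ^ 2),
      β ^ 2 / 4 / (1 + 2 * (α * γ) * (5 + 4 * α ^ 2))} : Finset ℝ), κ ≤ q :=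
    ⟨_, (Finset.lt_min'_iff _ (Finset.insert_nonempty _ _)).2 hs, fun q hq => Finset.min'_le _ q hq⟩
  simp only [Finset.mem_insert, Finset.mem_singleton, forall_eq_or_imp, forall_eq] at hκ
  obtain ⟨h1, h2, h3, h4, h5, h6⟩ := hκ
  rw [le_div_iff₀ hu, mul_comm] at h5
  rw [le_div_iff₀ hv] at h6
  exact ⟨3 + 2 * α + 2 * γ + 2 * α ^ 2 + 4 / β ^ 2 + 2 * (α * γ), κ, by linarith, by linarith,
    by linarith, by linarith, by linarith, by linarith, hκ0, h1, h2, h3, h4, h5, h6⟩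

/-- The approximate least squares coefficients: the right-hand side of the normal equations comes
from `B₁` and `r`, the Gram matrix from `B₃`, and its inverse from `K` Newton steps. -/
noncomputable def lsqApprox {N n : ℕ} (Z : ℝ) (m₁ m₂ K : ℕ) (t : ℝ)
    (B₁ : Matrix (Fin N) (Fin n) ℝ) (r : Fin N → ℝ) (B₃ : Matrix (Fin N) (Fin n) ℝ) : Fin n → ℝ :=
  mulVecApprox Z m₂ ((newtonApprox Z m₂ (matMulApprox Z m₁ B₃.transpose B₃))^[K] (t • 1))
    (mulVecApprox Z m₁ B₁.transpose r)

open scoped Matrix.Norms.L2Operator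

variable {N n : ℕ} {α β γ ε Z κ : ℝ}

/-- The approximate right-hand side of the normal equations. -/
lemma norm_mulVecApprox_rhs (hβ : 0 < β) (hα : 0 < α) (hγ : 0 < γ) (hε : 0 < ε) (hε1 : ε < 1 / 4)
    (hP : IsPrecision α β γ Z κ) (hn : 1 ≤ n) {B B₁ : Matrix (Fin N) (Fin n) ℝ}
    {r r₁ : Fin N → ℝ} (hB : ‖B‖ ≤ α) (hr : ‖WithLp.toLp 2 r‖ ≤ γ)
    (hB₁ : ‖B - B₁‖ ≤ tol₁ α β γ ε) (hr₁ : ‖WithLp.toLp 2 (r - r₁)‖ ≤ tol₂ α β γ ε) {m₁ : ℕ}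
    (hm₁ : n * n * (N * (Z ^ 2 / 4 ^ m₁)) ≤ κ * ε) :
    ‖WithLp.toLp 2 (B.transpose.mulVec r - mulVecApprox Z m₁ B₁.transpose r₁)‖ ≤
        11 / 48 * (ε * β ^ 2) + κ * ε ∧
      ‖WithLp.toLp 2 (mulVecApprox Z m₁ B₁.transpose r₁)‖ ≤ 2 * (α * γ) := by
  have hZ : 0 < Z := by linarith [hP.three_le]
  have hn' : (1 : ℝ) ≤ n := by exact_mod_cast hn
  have hκε : κ * ε ≤ κ := mul_le_of_le_one_right hP.pos.le (by linarith)
  have hB₁' : ‖B₁‖ ≤ α + α / 4 := by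
    have := norm_sub_le B (B - B₁)
    rw [sub_sub_cancel] at this
    linarith [tol₁_le_norm (α := α) (β := β) (γ := γ) (ε := ε)]
  have hr₁' : ‖WithLp.toLp 2 r₁‖ ≤ γ + γ / 4 := by
    have := norm_sub_le (WithLp.toLp 2 r) (WithLp.toLp 2 (r - r₁))
    rw [← WithLp.toLp_sub, sub_sub_cancel] at this
    linarith [tol₂_le_norm (α := α) (β := β) (γ := γ) (ε := ε)]
  set y := mulVecApprox Z m₁ B₁.transpose r₁
  have hy₁ : ‖WithLp.toLp 2 (y - B₁.transpose.mulVec r₁)‖ ≤ κ * ε := by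
    refine (norm_mulVecApprox_sub_le hZ m₁ ?_ ?_).trans (le_trans ?_ hm₁)
    · rw [norm_transpose]; linarith [hP.matrix_le]
    · linarith [hP.data_le]
    · gcongr
      exact le_mul_of_one_le_left (by positivity) hn'
  constructor
  · have h := (norm_transpose_mulVec_sub_le hB hB₁ hr hr₁).trans (rhs_tolerance_le hα hβ hγ hε)
    have e : B.transpose.mulVec r - y = (B.transpose.mulVec r - B₁.transpose.mulVec r₁) -
        (y - B₁.transpose.mulVec r₁) := by abel
    rw [e, WithLp.toLp_sub]
    exact (norm_sub_le _ _).trans (add_le_add h hy₁)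
  · have h1 : ‖WithLp.toLp 2 (B₁.transpose.mulVec r₁)‖ ≤ (α + α / 4) * (γ + γ / 4) := by
      refine (norm_toLp_mulVec_le _ _).trans ?_
      rw [norm_transpose]
      gcongr
    have h2 := norm_add_le (WithLp.toLp 2 (y - B₁.transpose.mulVec r₁))
      (WithLp.toLp 2 (B₁.transpose.mulVec r₁))
    rw [← WithLp.toLp_add, sub_add_cancel] at h2
    have h3 : (α + α / 4) * (γ + γ / 4) = 25 / 16 * (α * γ) := by ring
    linarith [hP.le_rhs, mul_pos hα hγ]

/-- The approximate Gram matrix. -/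
lemma norm_matMulApprox_gram (hβ : 0 < β) (hαβ : β < α) (hγ : 0 < γ) (hε : 0 < ε)
    (hε1 : ε < 1 / 4) (hP : IsPrecision α β γ Z κ) {B B₃ : Matrix (Fin N) (Fin n) ℝ}
    (hB : ‖B‖ ≤ α) (hB₃ : ‖B - B₃‖ ≤ tol₃ α β γ ε) {m₁ : ℕ}
    (hm₁ : n * n * (N * (Z ^ 2 / 4 ^ m₁)) ≤ κ * ε) :
    ‖matMulApprox Z m₁ B₃.transpose B₃ - B.transpose * B‖ ≤ β ^ 2 / 4 ∧
      ‖matMulApprox Z m₁ B₃.transpose B₃ - B.transpose * B‖ ≤ ε * β ^ 4 / (64 * (α * γ)) := by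
  have hα : 0 < α := hβ.trans hαβ
  have hZ : 0 < Z := by linarith [hP.three_le]
  have hκε : κ * ε ≤ κ := mul_le_of_le_one_right hP.pos.le (by linarith)
  have hB₃' : ‖B₃‖ ≤ α + α / 12 := by
    have := norm_sub_le B (B - B₃)
    rw [sub_sub_cancel] at this
    have h2 : β ^ 2 / (12 * α) ≤ α / 12 := by
      rw [div_le_div_iff₀ (by positivity) (by positivity)]; nlinarith
    linarith [tol₃_le_gap (α := α) (β := β) (γ := γ) (ε := ε)]
  have hG₁ : ‖matMulApprox Z m₁ B₃.transpose B₃ - B.transpose * B‖ ≤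
      (2 * α * tol₃ α β γ ε + tol₃ α β γ ε ^ 2) + κ * ε := by
    have h1 : ‖matMulApprox Z m₁ B₃.transpose B₃ - B₃.transpose * B₃‖ ≤ κ * ε := by
      refine (norm_matMulApprox_sub_le hZ m₁ ?_ ?_).trans hm₁
      · rw [norm_transpose]; linarith [hP.matrix_le]
      · linarith [hP.matrix_le]
    rw [← sub_add_sub_cancel' (B₃.transpose * B₃)]
    exact (norm_add_le _ _).trans (add_le_add (norm_gram_sub_gram_le hB hB₃) h1)
  obtain ⟨htol, htol'⟩ := gram_tolerance_le (ε := ε) hβ hαβ hγ hε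
  refine ⟨by linarith [hP.le_gap, sq_nonneg β], hG₁.trans ?_⟩
  have h1 : κ * ε ≤ β ^ 4 / (1728 * (α * γ)) * ε := by gcongr; exact hP.le_gram
  have h2 : β ^ 4 / (1728 * (α * γ)) * ε = 1 / 1728 * (ε * β ^ 4 / (α * γ)) := by
    field_simp
  have h3 : ε * β ^ 4 / (64 * (α * γ)) = 27 / 1728 * (ε * β ^ 4 / (α * γ)) := by
    field_simp; norm_num
  have h4 : 0 < ε * β ^ 4 / (α * γ) := by positivity
  linarith

lemma norm_one_sub_smul_le_of_perturbation (hβ : 0 < β) (hα : 0 < α)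
    {A G : Matrix (Fin n) (Fin n) ℝ} (hA : ‖1 - (α ^ 2)⁻¹ • A‖ ≤ 1 - β ^ 2 / α ^ 2)
    (hG : ‖G - A‖ ≤ β ^ 2 / 4) : ‖1 - (α ^ 2)⁻¹ • G‖ ≤ 1 - gap α β := by
  have e : 1 - (α ^ 2)⁻¹ • G = (1 - (α ^ 2)⁻¹ • A) - (α ^ 2)⁻¹ • (G - A) := by
    rw [smul_sub]; abel
  rw [e]
  refine (norm_sub_le _ _).trans ?_
  rw [norm_smul, Real.norm_of_nonneg (by positivity)]
  have h1 : (α ^ 2)⁻¹ * ‖G - A‖ ≤ (α ^ 2)⁻¹ * (β ^ 2 / 4) := by gcongr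
  have h2 : (α ^ 2)⁻¹ * (β ^ 2 / 4) = β ^ 2 / α ^ 2 / 4 := by field_simp
  have h3 : gap α β = β ^ 2 / α ^ 2 / 2 := by rw [gap]; field_simp
  have h4 : 0 < β ^ 2 / α ^ 2 := by positivity
  linarith

lemma gap_pos (hβ : 0 < β) (hα : 0 < α) : 0 < gap α β := by unfold gap; positivity

lemma gap_le_one (hβ : 0 < β) (hαβ : β < α) : gap α β ≤ 1 := by
  have hα : 0 < α := hβ.trans hαβ
  unfold gap
  rw [div_le_one₀ (by positivity)]
  nlinarith

/-- The approximate inverse of the Gram matrix. -/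
lemma norm_newtonApprox_gram (hβ : 0 < β) (hαβ : β < α) (hε : 0 < ε) (hε1 : ε < 1 / 4)
    (hP : IsPrecision α β γ Z κ) {G : Matrix (Fin n) (Fin n) ℝ}
    (hgapG : ‖1 - (α ^ 2)⁻¹ • G‖ ≤ 1 - gap α β) (hG : ‖G‖ ≤ 2 * α ^ 2) {m₂ K : ℕ}
    (hm₂ : n * n * (n * (Z ^ 2 / 4 ^ m₂)) ≤ κ * ε) (hK : (1 - gap α β ^ 2) ^ 2 ^ K ≤ κ * ε) :
    ‖(newtonApprox Z m₂ G)^[K] ((α ^ 2)⁻¹ • 1)‖ ≤ 4 / β ^ 2 ∧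
      ‖1 - G * (newtonApprox Z m₂ G)^[K] ((α ^ 2)⁻¹ • 1)‖ ≤ (5 + 4 * α ^ 2) * (κ * ε) := by
  have hα : 0 < α := hβ.trans hαβ
  have hκε : κ * ε ≤ κ := mul_le_of_le_one_right hP.pos.le (by linarith)
  have hgap0 := gap_pos hβ hα
  have hinv : 2 * (α ^ 2)⁻¹ / gap α β = 4 / β ^ 2 := by unfold gap; field_simp; norm_num
  have hδθ : (2 + 2 * α ^ 2) * (κ * ε) ≤ gap α β ^ 2 / 8 :=
    le_trans (by gcongr) hP.newton_le
  obtain ⟨hX₁, hX₂⟩ := norm_residual_newtonApprox_iterate_le (A := G) (t := (α ^ 2)⁻¹) (Z := Z)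
    (m := m₂) (by positivity) hgap0 (gap_le_one hβ hαβ) hgapG hG hP.gram_le
    (hinv.trans_le hP.inverse_le) hP.three_le hm₂ (by linarith [hP.le_quarter]) hδθ K
  refine ⟨hinv ▸ norm_le_of_norm_one_sub_mul_le norm_one_le (by positivity) hgap0 hgapG hX₁, ?_⟩
  linarith

/-- The error of `X y`, for approximations `G` of the Gram matrix, `X` of `G⁻¹` and `y` of the
right-hand side, is controlled by its defect in the exact normal equations. -/
lemma norm_sub_mulVec_le (hβ : 0 < β) (hα : 0 < α) (hγ : 0 < γ) (hε : 0 < ε)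
    (hP : IsPrecision α β γ Z κ) {A G X : Matrix (Fin n) (Fin n) ℝ} {b c y : Fin n → ℝ}
    (hA : ‖1 - (α ^ 2)⁻¹ • A‖ ≤ 1 - β ^ 2 / α ^ 2) (hc : A.mulVec c = b)
    (hG : ‖G - A‖ ≤ ε * β ^ 4 / (64 * (α * γ))) (hX : ‖X‖ ≤ 4 / β ^ 2)
    (hGX : ‖1 - G * X‖ ≤ (5 + 4 * α ^ 2) * (κ * ε))
    (hy : ‖WithLp.toLp 2 (b - y)‖ ≤ 11 / 48 * (ε * β ^ 2) + κ * ε)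
    (hy' : ‖WithLp.toLp 2 y‖ ≤ 2 * (α * γ)) :
    ‖WithLp.toLp 2 (c - X.mulVec y)‖ ≤ 3 / 4 * ε := by
  have hκ := hP.pos
  have hres : ‖1 - A * X‖ ≤ (5 + 4 * α ^ 2) * (κ * ε) + ε * β ^ 2 / (16 * (α * γ)) := by
    have e : 1 - A * X = (1 - G * X) + (G - A) * X := by rw [Matrix.sub_mul]; abel
    rw [e]
    refine (norm_add_le _ _).trans ?_
    have h1 : ‖(G - A) * X‖ ≤ ε * β ^ 4 / (64 * (α * γ)) * (4 / β ^ 2) :=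
      (norm_mul_le _ _).trans (mul_le_mul hG hX (norm_nonneg _) (by positivity))
    have h2 : ε * β ^ 4 / (64 * (α * γ)) * (4 / β ^ 2) = ε * β ^ 2 / (16 * (α * γ)) := by
      field_simp; norm_num
    linarith
  have hdef : ‖WithLp.toLp 2 (A.mulVec (c - X.mulVec y))‖ ≤ β ^ 2 * (3 / 4 * ε) := by
    have e : A.mulVec (c - X.mulVec y) = (b - y) + (1 - A * X).mulVec y := by
      rw [Matrix.mulVec_sub, hc, Matrix.sub_mulVec, Matrix.one_mulVec, Matrix.mulVec_mulVec]
      abel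
    rw [e, WithLp.toLp_add]
    refine (norm_add_le _ _).trans ?_
    have h1 := (norm_toLp_mulVec_le (1 - A * X) y).trans
      (mul_le_mul hres hy' (norm_nonneg _) (by positivity))
    have h2 : ((5 + 4 * α ^ 2) * (κ * ε) + ε * β ^ 2 / (16 * (α * γ))) * (2 * (α * γ)) =
        κ * (1 + 2 * (α * γ) * (5 + 4 * α ^ 2)) * ε - κ * ε + ε * β ^ 2 / 8 := by
      field_simp; ring
    have h3 := mul_le_mul_of_nonneg_right hP.residual_le hε.le
    have h4 : 0 < ε * β ^ 2 := by positivity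
    rw [h2] at h1
    linarith
  have h := mul_norm_le_norm_mulVec (by positivity) hA (c - X.mulVec y)
  have h1 := h.trans (mul_le_mul_of_nonneg_left hdef (by positivity))
  have h2 : (α ^ 2)⁻¹ * (β ^ 2 * (3 / 4 * ε)) = β ^ 2 / α ^ 2 * (3 / 4 * ε) := by field_simp
  rw [h2] at h1
  exact le_of_mul_le_mul_left h1 (by positivity)

/-- The total error: the defect in the normal equations and the last multiplication. -/
theorem norm_leastSquares_sub_lsqApprox_le (hβ : 0 < β) (hαβ : β < α)
    (hγ : 0 < γ) (hε : 0 < ε) (hε1 : ε < 1 / 4) (hP : IsPrecision α β γ Z κ) (hn : 1 ≤ n)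
    {B B₁ B₃ : Matrix (Fin N) (Fin n) ℝ} {r r₁ : Fin N → ℝ}
    (hspec : spectrum ℝ (B.transpose * B) ⊆ Set.Icc (β ^ 2) (α ^ 2))
    (hr : ‖WithLp.toLp 2 r‖ ≤ γ) (hB₁ : ‖B - B₁‖ ≤ tol₁ α β γ ε)
    (hr₁ : ‖WithLp.toLp 2 (r - r₁)‖ ≤ tol₂ α β γ ε) (hB₃ : ‖B - B₃‖ ≤ tol₃ α β γ ε)
    {m₁ m₂ K : ℕ} (hm₁ : n * n * (N * (Z ^ 2 / 4 ^ m₁)) ≤ κ * ε)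
    (hm₂ : n * n * (n * (Z ^ 2 / 4 ^ m₂)) ≤ κ * ε)
    (hK : (1 - gap α β ^ 2) ^ 2 ^ K ≤ κ * ε) :
    ‖WithLp.toLp 2 (leastSquares B r - lsqApprox Z m₁ m₂ K (α ^ 2)⁻¹ B₁ r₁ B₃)‖ ≤ ε := by
  have hα : 0 < α := hβ.trans hαβ
  have hZ : 0 < Z := by linarith [hP.three_le]
  have hB := norm_le_of_spectrum_gram hα hspec
  have hA := norm_one_sub_gram_le hβ hαβ hspec
  have hc := gram_mulVec_leastSquares hβ hspec r
  obtain ⟨hy₁, hy₂⟩ := norm_mulVecApprox_rhs hβ hα hγ hε hε1 hP hn hB hr hB₁ hr₁ hm₁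
  obtain ⟨hG₁, hG₂⟩ := norm_matMulApprox_gram hβ hαβ hγ hε hε1 hP hB hB₃ hm₁
  have hA2 : ‖B.transpose * B‖ ≤ α ^ 2 := by
    rw [sq]
    refine (Matrix.l2_opNorm_mul _ _).trans ?_
    rw [norm_transpose]
    gcongr
  have hG : ‖matMulApprox Z m₁ B₃.transpose B₃‖ ≤ 2 * α ^ 2 := by
    have h1 := norm_add_le (matMulApprox Z m₁ B₃.transpose B₃ - B.transpose * B) (B.transpose * B)
    rw [sub_add_cancel] at h1
    have h2 : β ^ 2 ≤ α ^ 2 := by gcongr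
    linarith [sq_nonneg α]
  obtain ⟨hX₁, hX₂⟩ := norm_newtonApprox_gram hβ hαβ hε hε1 hP
    (norm_one_sub_smul_le_of_perturbation hβ hα hA hG₁) hG hm₂ hK
  have hfinal := norm_sub_mulVec_le hβ hα hγ hε hP hA hc hG₂ hX₁ hX₂ hy₁ hy₂
  have hz := norm_mulVecApprox_sub_le hZ m₂ (hX₁.trans hP.inverse_le) (hy₂.trans hP.rhs_le)
  have hz' : (n * (n * (Z ^ 2 / 4 ^ m₂)) : ℝ) ≤ κ * ε := by
    refine le_trans ?_ hm₂
    gcongr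
    exact le_mul_of_one_le_left (by positivity) (by exact_mod_cast hn)
  have h := norm_sub_le _ _ |>.trans (add_le_add hfinal (hz.trans hz'))
  rw [← WithLp.toLp_sub, sub_sub_sub_cancel_right] at h
  refine h.trans ?_
  linarith [mul_le_mul_of_nonneg_right hP.le_quarter hε.le]

end PODDNN

/-! ### The network of the approximate least squares solution -/

namespace NetFn

variable {p n N : ℕ}

lemma reindex {ι κ : Type} [Fintype ι] [Fintype κ] {F : (Fin p → ℝ) → ι → ℝ} {d c : ℕ}
    (h : NetFn F d c) (e : κ ≃ ι) : NetFn (fun x k => F x (e k)) d c := by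
  cases h with
  | affine W b hc =>
    refine affine (fun k => W (e k)) (fun k => b (e k)) ?_
    rwa [nz_comp_equiv b e, e.sum_comp fun i => nz (W i)]
  | @layer _ _ _ _ F d c c' T hF hT =>
    obtain ⟨r, h1, h2⟩ := hT
    exact layer (T := fun x k => T x (e k)) hF
      ⟨fun k => r (e k), fun k => h1 (e k), (e.sum_comp r).trans_le h2⟩

/-- `bilinear` without coordinates that are handed on. -/
lemma scalarProducts {ι κ S : Type} [Fintype ι] [Fintype κ] [Fintype S]
    {F : (Fin p → ℝ) → ι → ℝ} {d c : ℕ} (hF : NetFn F d c) (l r : κ → S → ι) (Z : ℝ) (m : ℕ) :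
    NetFn (fun x k => ∑ s, mulApprox Z m (F x (l k s)) (F x (r k s))) (d + (m + 2))
      (c + Fintype.card κ * Fintype.card S * (12 * m + 10)) := by
  have := (hF.bilinear l r (Empty.elim : Empty → ι) Z m).reindex (Equiv.sumEmpty κ Empty).symm
  simpa using this

/-- The right-hand side of the normal equations. -/
lemma rhs {b : (Fin p → ℝ) → Fin (n * N) → ℝ} {r : (Fin p → ℝ) → Fin N → ℝ} {d₁ d₂ c₁ c₂ : ℕ}
    (hb : NetFn b d₁ c₁) (hr : NetFn r d₂ c₂) (Z : ℝ) (m : ℕ) :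
    NetFn (fun x => mulVecApprox Z m (PODDNN.matr (b x)).transpose (r x)) (d₁ + d₂ + (m + 2))
      (c₁ + d₂ * (2 * (n * N)) + (c₂ + d₁ * (2 * N)) + n * N * (12 * m + 10)) := by
  have h₂ := hr.pad d₁
  rw [add_comm d₂] at h₂
  have := ((hb.pad d₂).pair h₂).scalarProducts
    (fun (k : Fin n) (s : Fin N) => Sum.inl (finProdFinEquiv (k, s))) (fun _ s => Sum.inr s) Z m
  simp only [Fintype.card_fin] at this
  exact this

/-- The Gram matrix. -/
lemma gram {b : (Fin p → ℝ) → Fin (n * N) → ℝ} {d c : ℕ} (hb : NetFn b d c) (Z : ℝ) (m : ℕ) :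
    NetFn (fun x => flat (matMulApprox Z m (PODDNN.matr (b x)).transpose (PODDNN.matr (b x))))
      (d + (m + 2)) (c + n * n * N * (12 * m + 10)) := by
  have := hb.scalarProducts (fun (k : Fin n × Fin n) (s : Fin N) => finProdFinEquiv (k.1, s))
    (fun k s => finProdFinEquiv (k.2, s)) Z m
  simp only [Fintype.card_fin, Fintype.card_prod] at this
  exact this

/-- The initial value `t • 1` of the Newton iteration. -/
lemma newton_init {A : (Fin p → ℝ) → Matrix (Fin n) (Fin n) ℝ} {y : (Fin p → ℝ) → Fin n → ℝ}
    {d c : ℕ} (h : NetFn (fun x => Sum.elim (y x) (flat (A x))) d c) (t : ℝ) :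
    NetFn (fun x => Sum.elim (flat (t • (1 : Matrix (Fin n) (Fin n) ℝ)))
      (Sum.elim (y x) (flat (A x)))) (d + 1) (c + (n * n + (n + n * n) * 2)) := by
  have := layer h ((IsLayer.of_rows (c := 1) (T := fun (_ : Fin n ⊕ Fin n × Fin n → ℝ)
      (k : Fin n × Fin n) => (t • (1 : Matrix (Fin n) (Fin n) ℝ)) k.1 k.2)
      fun k => IsRow.const _).elim
    (IsLayer.of_rows (T := fun x : Fin n ⊕ Fin n × Fin n → ℝ => x) fun q => IsRow.coord q))
  simp only [Fintype.card_fin, Fintype.card_prod, Fintype.card_sum, mul_one] at this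
  exact this

/-- The network of the approximate least squares coefficients. Before the branches are joined, the
right-hand side is carried through the depth of `ΦB₃` and the Gram matrix through the depths of
`ΦB₁` and `Φfg`; only the data of the branch of the right-hand side are synchronized at full size
`N * n`. -/
theorem exists_reluNet_lsqApprox (ΦB₁ ΦB₃ : ReLUNet p (n * N)) (Φfg : ReLUNet p N) (Z t : ℝ)
    (m₁ m₂ K : ℕ) :
    ∃ Φ : ReLUNet p n,
      (∀ x, Φ.realize x = PODDNN.lsqApprox Z m₁ m₂ K t (PODDNN.matr (ΦB₁.realize x))
        (Φfg.realize x) (PODDNN.matr (ΦB₃.realize x))) ∧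
      Φ.depth = ΦB₁.depth + Φfg.depth + ΦB₃.depth + (m₁ + 3) + K * (2 * m₂ + 5) + (m₂ + 2) ∧
      Φ.numParams ≤ 2 * (ΦB₁.numParams + Φfg.numParams + ΦB₃.numParams +
        Φfg.depth * (2 * (n * N)) + ΦB₁.depth * (2 * N) + ΦB₃.depth * (2 * n) +
        (ΦB₁.depth + Φfg.depth) * (2 * (n * n)) + (n * N + n * n * N) * (12 * m₁ + 10) +
        (3 * (n * n) + 2 * n) + K * (n ^ 3 * (50 * (m₂ + 1))) + n * n * (12 * m₂ + 10)) := by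
  have h₁ := (rhs (of_reluNet ΦB₁) (of_reluNet Φfg) Z m₁).pad ΦB₃.depth
  have h₂ := (gram (of_reluNet ΦB₃) Z m₁).pad (ΦB₁.depth + Φfg.depth)
  rw [show ΦB₃.depth + (m₁ + 2) + (ΦB₁.depth + Φfg.depth) =
    ΦB₁.depth + Φfg.depth + (m₁ + 2) + ΦB₃.depth by ring] at h₂
  have h₃ := (((h₁.pair h₂).newton_init t).newton_iterate Z m₂ K).scalarProducts
    (fun k s : Fin n => Sum.inl (k, s)) (fun _ s => Sum.inr (Sum.inl s)) Z m₂
  obtain ⟨Φ, h4, h5, h6⟩ := h₃.exists_reluNet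
  refine ⟨Φ, fun x => (h4 x).trans rfl, h5.trans (by ring), h6.trans (le_of_eq ?_)⟩
  simp only [Fintype.card_fin, Fintype.card_prod]
  ring

end NetFn

/-! ### The choice of the accuracies -/

namespace PODDNN

/-- `log₂ (1 / ε) + 3 log₂ s + O(1)` bits suffice for `s ^ 3` products with total error `κ * ε`. -/
lemma exists_numBits {Z κ : ℝ} (hZ : 3 ≤ Z) (hκ : 0 < κ) (hκ1 : κ ≤ 1 / 4) :
    ∃ C : ℝ, 0 ≤ C ∧ ∀ (s : ℕ) (ε : ℝ), 1 ≤ s → 0 < ε → ε < 1 / 4 → ∃ m : ℕ,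
      (s : ℝ) ^ 3 * (Z ^ 2 / 4 ^ m) ≤ κ * ε ∧
        (m : ℝ) ≤ C + Real.logb 2 (1 / ε) + 3 * Real.logb 2 s := by
  have hq : 1 ≤ Z ^ 2 / κ := by
    rw [le_div_iff₀ hκ]; nlinarith
  refine ⟨Real.logb 2 (Z ^ 2 / κ) + 1, ?_, fun s ε hs hε hε1 => ?_⟩
  · have := Real.logb_nonneg one_lt_two hq
    linarith
  have hs' : (1 : ℝ) ≤ s := by exact_mod_cast hs
  have hε2 : 1 ≤ 1 / ε := by rw [le_div_iff₀ hε]; linarith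
  set w := Real.logb 2 (Z ^ 2 / κ) + Real.logb 2 (1 / ε) + 3 * Real.logb 2 s with hw
  have hw0 : 0 ≤ w := by
    have := Real.logb_nonneg one_lt_two hq
    have := Real.logb_nonneg one_lt_two hε2
    have := Real.logb_nonneg one_lt_two hs'
    positivity
  refine ⟨⌈w⌉₊, ?_, by linarith [(Nat.ceil_lt_add_one hw0).le]⟩
  have h2 : (2 : ℝ) ^ w = Z ^ 2 / κ * (1 / ε) * (s : ℝ) ^ 3 := by
    have h0 : (0 : ℝ) < 2 := two_pos
    rw [hw, Real.rpow_add h0, Real.rpow_add h0, mul_comm 3, Real.rpow_mul h0.le,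
      Real.rpow_logb h0 (by norm_num) (by positivity), Real.rpow_logb h0 (by norm_num)
      (by positivity), Real.rpow_logb h0 (by norm_num) (by positivity)]
    norm_cast
  have h4 : Z ^ 2 / κ * (1 / ε) * (s : ℝ) ^ 3 ≤ 4 ^ ⌈w⌉₊ := by
    rw [← h2]
    calc (2 : ℝ) ^ w ≤ 2 ^ (⌈w⌉₊ : ℝ) :=
          Real.rpow_le_rpow_of_exponent_le (by norm_num) (Nat.le_ceil w)
      _ = 2 ^ ⌈w⌉₊ := Real.rpow_natCast _ _
      _ ≤ 4 ^ ⌈w⌉₊ := by gcongr; norm_num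
  rw [mul_div_assoc', div_le_iff₀ (by positivity)]
  calc (s : ℝ) ^ 3 * Z ^ 2 = κ * ε * (Z ^ 2 / κ * (1 / ε) * (s : ℝ) ^ 3) := by field_simp
    _ ≤ _ := by gcongr

/-- `log₂ (log₂ (1 / ε)) + O(1)` squarings reduce `1 - g ^ 2` to `κ * ε`. -/
lemma exists_numSteps {g κ : ℝ} (hg : 0 < g) (hg1 : g ≤ 1) (hκ : 0 < κ) (hκ1 : κ ≤ 1 / 4) :
    ∃ C : ℝ, 0 ≤ C ∧ ∀ ε : ℝ, 0 < ε → ε < 1 / 4 → ∃ K : ℕ,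
      (1 - g ^ 2) ^ 2 ^ K ≤ κ * ε ∧ (K : ℝ) ≤ C + Real.logb 2 (Real.logb 2 (1 / ε)) := by
  obtain ⟨k, hk⟩ := pow_unbounded_of_one_lt ((1 + Real.log (1 / κ)) / g ^ 2) (one_lt_two (α := ℝ))
  refine ⟨k + 1, by positivity, fun ε hε hε1 => ?_⟩
  have hlog2 : Real.log 2 < 1 := by linarith [Real.log_two_lt_d9]
  have hlog20 : 0 < Real.log 2 := Real.log_pos one_lt_two
  have hε4 : 4 ≤ 1 / ε := by rw [le_div_iff₀ hε]; linarith
  have hlam : 2 ≤ Real.logb 2 (1 / ε) := by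
    rw [Real.le_logb_iff_rpow_le one_lt_two (by positivity)]
    norm_num at hε4 ⊢
    exact hε4
  set lam := Real.logb 2 (1 / ε) with hlam_def
  have hln : Real.log (1 / ε) ≤ lam := by
    rw [hlam_def, Real.logb, le_div_iff₀ hlog20]
    exact mul_le_of_le_one_right (Real.log_nonneg (by linarith)) hlog2.le
  have hell : 0 ≤ Real.logb 2 lam := Real.logb_nonneg one_lt_two (by linarith)
  refine ⟨k + ⌈Real.logb 2 lam⌉₊, ?_, ?_⟩
  · have h1 : lam ≤ 2 ^ ⌈Real.logb 2 lam⌉₊ := by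
      calc lam = 2 ^ Real.logb 2 lam := (Real.rpow_logb two_pos (by norm_num) (by linarith)).symm
        _ ≤ 2 ^ (⌈Real.logb 2 lam⌉₊ : ℝ) :=
            Real.rpow_le_rpow_of_exponent_le (by norm_num) (Nat.le_ceil _)
        _ = _ := Real.rpow_natCast _ _
    have hκln : 0 ≤ Real.log (1 / κ) :=
      Real.log_nonneg (by rw [le_div_iff₀ hκ]; linarith)
    have h2 : Real.log (1 / κ) + Real.log (1 / ε) ≤ g ^ 2 * 2 ^ (k + ⌈Real.logb 2 lam⌉₊) := by
      rw [div_lt_iff₀ (by positivity)] at hk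
      calc Real.log (1 / κ) + Real.log (1 / ε) ≤ (1 + Real.log (1 / κ)) * lam := by nlinarith
        _ ≤ (2 ^ k * g ^ 2) * 2 ^ ⌈Real.logb 2 lam⌉₊ := by gcongr
        _ = _ := by rw [pow_add]; ring
    calc (1 - g ^ 2) ^ 2 ^ (k + ⌈Real.logb 2 lam⌉₊)
        ≤ Real.exp (-g ^ 2) ^ 2 ^ (k + ⌈Real.logb 2 lam⌉₊) := by
          refine pow_le_pow_left₀ (by nlinarith) ?_ _
          linarith [Real.add_one_le_exp (-g ^ 2)]
      _ = Real.exp (-(g ^ 2 * 2 ^ (k + ⌈Real.logb 2 lam⌉₊))) := by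
          rw [← Real.exp_nat_mul]; push_cast; ring_nf
      _ ≤ Real.exp (-(Real.log (1 / κ) + Real.log (1 / ε))) := by gcongr
      _ = κ * ε := by
          rw [one_div, one_div, Real.log_inv, Real.log_inv, neg_add, neg_neg, neg_neg, Real.exp_add,
            Real.exp_log hκ, Real.exp_log hε]
  · push_cast
    linarith [(Nat.ceil_lt_add_one hell).le]

end PODDNN

/-! ### The bounds on depth and size -/

lemma le_of_transpose_mul_self_eq_one {N n : ℕ} {V : Matrix (Fin N) (Fin n) ℝ}
    (hV : V.transpose * V = 1) : n ≤ N := by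
  have h1 : (V.transpose * V).rank = n := by rw [hV, Matrix.rank_one, Fintype.card_fin]
  have h2 := (Matrix.rank_mul_le_right V.transpose V).trans (Matrix.rank_le_height V)
  omega

/-- The depth in terms of the logarithms `lam` of `1 / ε`, `ell` of `lam`, `a` of `n` and `b` of
`N`. -/
lemma depth_bound {C C' lam ell a b m₁ m₂ K : ℝ} (hC : 0 ≤ C) (hC' : 0 ≤ C') (hlam : 2 ≤ lam)
    (hell : 1 ≤ ell) (ha : 0 ≤ a) (hb : 0 ≤ b) (hm₂0 : 0 ≤ m₂)
    (hm₁ : m₁ ≤ C + lam + 3 * b) (hm₂ : m₂ ≤ C + lam + 3 * a) (hK : K ≤ C' + ell) :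
    m₁ + 3 + K * (2 * m₂ + 5) + (m₂ + 2) ≤
      2 * (C + 9) * (C' + 3) * ell * (lam + a) + 2 * (C + 9) * (C' + 3) * b := by
  have h1 : m₁ + 3 ≤ (C + 9) * (lam + b) := by nlinarith [mul_nonneg hC hb]
  have h2 : m₂ + 3 ≤ (C + 9) * (lam + a) := by nlinarith [mul_nonneg hC ha]
  have h3 : K ≤ (C' + 1) * ell := by nlinarith
  set D := C + 9
  have hD : 9 ≤ D := by simp only [D]; linarith
  have h4 : K * (2 * m₂ + 5) ≤ (C' + 1) * ell * (2 * (D * (lam + a))) := by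
    refine mul_le_mul h3 (by linarith) (by linarith) (by positivity)
  have h5 : D * (lam + a) ≤ ell * (D * (lam + a)) := le_mul_of_one_le_left (by positivity) hell
  have h6 : 0 ≤ ell * (D * (lam + a)) := by positivity
  have h7 : 0 ≤ D * b := by positivity
  have h8 : 0 ≤ C' * (D * b) := by positivity
  have h9 : 0 ≤ D * a := by positivity
  nlinarith

/-- The parameters that belong to the arithmetic. -/
lemma arithmetic_params_bound {C C' lam ell a b m₁ m₂ K x y : ℝ} (hC : 0 ≤ C) (hC' : 0 ≤ C')
    (hlam : 2 ≤ lam) (hell : 1 ≤ ell) (hel : ell ≤ lam) (ha : 0 ≤ a) (hb : 0 ≤ b) (hm₁0 : 0 ≤ m₁)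
    (hm₂0 : 0 ≤ m₂) (hm₁ : m₁ ≤ C + lam + 3 * b) (hm₂ : m₂ ≤ C + lam + 3 * a)
    (hK : K ≤ C' + ell) (hx : 1 ≤ x) (hxy : x ≤ y) :
    2 * ((x * y + x * x * y) * (12 * m₁ + 10) + (3 * (x * x) + 2 * x) +
        K * (x ^ 3 * (50 * (m₂ + 1))) + x * x * (12 * m₂ + 10)) ≤
      200 * (C + 9) * (C' + 2) * y * x ^ 2 * (lam + b) +
      200 * (C + 9) * (C' + 2) * x ^ 2 * lam * (ell + x) * (lam + a) +
      200 * (C + 9) * (C' + 2) * x ^ 2 * ell * b := by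
  have h1 : m₁ + 1 ≤ (C + 9) * (lam + b) := by nlinarith [mul_nonneg hC hb]
  have h2 : m₂ + 1 ≤ (C + 9) * (lam + a) := by nlinarith [mul_nonneg hC ha]
  have h3 : K ≤ (C' + 1) * lam := by nlinarith
  set D := C + 9
  have hD : 9 ≤ D := by simp only [D]; linarith
  have hx2 : x ≤ x ^ 2 := by nlinarith
  have hy : 0 ≤ y := by linarith
  have g1 : (x * y + x * x * y) * (12 * m₁ + 10) ≤ (2 * (y * x ^ 2)) * (12 * (D * (lam + b))) := by
    refine mul_le_mul ?_ (by linarith) (by linarith) (by positivity)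
    nlinarith
  have g2 : 3 * (x * x) + 2 * x ≤ y * x ^ 2 * (D * (lam + b)) := by
    have h5 : 5 ≤ y * (D * (lam + b)) := by
      have : 9 * 2 ≤ D * (lam + b) := mul_le_mul hD (by linarith) (by norm_num) (by linarith)
      nlinarith
    nlinarith [mul_le_mul_of_nonneg_left h5 (sq_nonneg x)]
  have g3 : K * (x ^ 3 * (50 * (m₂ + 1))) ≤
      (C' + 1) * lam * (x ^ 3 * (50 * (D * (lam + a)))) := by
    refine mul_le_mul h3 (by gcongr) (by positivity) (by positivity)
  have g4 : x * x * (12 * m₂ + 10) ≤ 12 * (x ^ 2 * (D * (lam + a))) := by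
    nlinarith [mul_le_mul_of_nonneg_left h2 (sq_nonneg x)]
  have e1 : 0 ≤ y * x ^ 2 * (D * (lam + b)) := by positivity
  have e1' : 0 ≤ C' * (y * x ^ 2 * (D * (lam + b))) := by positivity
  have e2 : 0 ≤ D * (C' + 2) * x ^ 2 * ell * b := by positivity
  have e3 : 0 ≤ D * (C' + 2) * x ^ 2 * lam * ell * (lam + a) := by positivity
  have e4 : x ^ 2 * (D * (lam + a)) ≤ x ^ 2 * (D * (lam + a)) * (lam * x) :=
    le_mul_of_one_le_right (by positivity) (by nlinarith)
  have e5 : 0 ≤ x ^ 2 * (D * (lam + a)) * (lam * x) := by positivity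
  have e6 : 0 ≤ C' * (x ^ 2 * (D * (lam + a)) * (lam * x)) := by positivity
  nlinarith

/-- The parameters that belong to the given networks. -/
lemma data_params_bound {M₁ M₂ M₃ L₁ L₂ L₃ x y : ℝ} (hM₁ : 0 ≤ M₁) (hM₂ : 0 ≤ M₂) (hM₃ : 0 ≤ M₃)
    (hL₁ : 0 ≤ L₁) (hL₂ : 0 ≤ L₂) (hL₃ : 0 ≤ L₃) (hx : 1 ≤ x) (hxy : x ≤ y) :
    2 * (M₁ + M₂ + M₃ + L₂ * (2 * (x * y)) + L₁ * (2 * y) + L₃ * (2 * x) +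
        (L₁ + L₂) * (2 * (x * x))) ≤
      16 * M₁ + 16 * M₂ + 8 * M₃ + 80 * y * x * L₁ + 80 * y * x * L₂ + 16 * x ^ 2 * L₃ := by
  have h1 : L₁ * y ≤ L₁ * (x * y) := by gcongr; nlinarith
  have h2 : L₃ * x ≤ L₃ * (x * x) := by gcongr; nlinarith
  have h3 : (L₁ + L₂) * (x * x) ≤ (L₁ + L₂) * (x * y) := by gcongr
  have h4 : 0 ≤ L₁ * (x * y) := mul_nonneg hL₁ (by nlinarith)
  have h5 : 0 ≤ L₂ * (x * y) := mul_nonneg hL₂ (by nlinarith)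
  have h6 : 0 ≤ L₃ * (x * x) := by positivity
  nlinarith

theorem mainTheorem1 (α β γ : ℝ) (hβ : 0 < β) (hαβ : β < α) (hγ : 0 < γ) :
    ∃ C_L C_M : ℝ,
      ∀ (p NI NB n : ℕ)
        -- the parameter domain, the discretized operator and the right-hand sides
        (D : Set (Fin p → ℝ))
        (L : (Fin p → ℝ) → Matrix (Fin NI) (Fin (NI + NB)) ℝ)
        (f : (Fin p → ℝ) → Fin NI → ℝ) (g : (Fin p → ℝ) → Fin NB → ℝ)
        -- the reduced basis
        (V : Matrix (Fin (NI + NB)) (Fin n) ℝ)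
        (_hV : V.transpose * V = 1)
        -- spectral bounds and the bound on the data
        (_hspec : ∀ μ ∈ D,
          spectrum ℝ ((PODDNN.reducedMatrix (L μ) V).transpose * PODDNN.reducedMatrix (L μ) V) ⊆
            Set.Icc (β ^ 2) (α ^ 2))
        (_hdata : ∀ μ ∈ D, PODDNN.vecNorm (Fin.append (f μ) (g μ)) ≤ γ)
        -- networks that approximate the reduced matrix
        (ΦB : ℝ → ReLUNet p (n * (NI + NB)))
        (_hΦB : ∀ η : ℝ, 0 < η → ∀ μ ∈ D,
          PODDNN.specNorm
            (PODDNN.reducedMatrix (L μ) V - PODDNN.matr ((ΦB η).realize μ)) ≤ η)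
        -- networks that approximate the data
        (Φfg : ℝ → ReLUNet p (NI + NB))
        (_hΦfg : ∀ η : ℝ, 0 < η → ∀ μ ∈ D,
          PODDNN.vecNorm (Fin.append (f μ) (g μ) - (Φfg η).realize μ) ≤ η)
        (ε : ℝ) (_hε : 0 < ε) (_hε' : ε < 1 / 4),
        ∃ Φ : ReLUNet p n,
          (∀ μ ∈ D,
            PODDNN.vecNorm
              (PODDNN.leastSquares (PODDNN.reducedMatrix (L μ) V) (Fin.append (f μ) (g μ)) -
                Φ.realize μ) ≤ ε) ∧
          (Φ.depth : ℝ) ≤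
            C_L * Real.logb 2 (Real.logb 2 (1 / ε)) * (Real.logb 2 (1 / ε) + Real.logb 2 n) +
            C_L * Real.logb 2 ((NI + NB : ℕ) : ℝ) +
            (ΦB (PODDNN.tol₃ α β γ ε)).depth + (ΦB (PODDNN.tol₁ α β γ ε)).depth +
            (Φfg (PODDNN.tol₂ α β γ ε)).depth ∧
          (Φ.numParams : ℝ) ≤
            C_M * ((NI + NB : ℕ) : ℝ) * (n : ℝ) ^ 2 *
              (Real.logb 2 (1 / ε) + Real.logb 2 ((NI + NB : ℕ) : ℝ)) +
            C_M * (n : ℝ) ^ 2 * Real.logb 2 (1 / ε) *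
              (Real.logb 2 (Real.logb 2 (1 / ε)) + n) *
              (Real.logb 2 (1 / ε) + Real.logb 2 n) +
            C_M * (n : ℝ) ^ 2 * Real.logb 2 (Real.logb 2 (1 / ε)) *
              Real.logb 2 ((NI + NB : ℕ) : ℝ) +
            16 * (ΦB (PODDNN.tol₁ α β γ ε)).numParams +
            16 * (Φfg (PODDNN.tol₂ α β γ ε)).numParams +
            8 * (ΦB (PODDNN.tol₃ α β γ ε)).numParams +
            80 * ((NI + NB : ℕ) : ℝ) * n * (ΦB (PODDNN.tol₁ α β γ ε)).depth +
            80 * ((NI + NB : ℕ) : ℝ) * n * (Φfg (PODDNN.tol₂ α β γ ε)).depth +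
            16 * (n : ℝ) ^ 2 * (ΦB (PODDNN.tol₃ α β γ ε)).depth := by
  have hα : 0 < α := hβ.trans hαβ
  obtain ⟨Z, κ, hP⟩ := PODDNN.exists_isPrecision hα hβ hγ
  obtain ⟨C, hC, hbits⟩ := PODDNN.exists_numBits hP.three_le hP.pos hP.le_quarter
  obtain ⟨C', hC', hsteps⟩ := PODDNN.exists_numSteps (PODDNN.gap_pos hβ hα)
    (PODDNN.gap_le_one hβ hαβ) hP.pos hP.le_quarter
  refine ⟨2 * (C + 9) * (C' + 3), 200 * (C + 9) * (C' + 2), ?_⟩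
  intro p NI NB n D L f g V hV hspec hdata ΦB hΦB Φfg hΦfg ε hε hε1
  have hlam : 2 ≤ Real.logb 2 (1 / ε) := by
    rw [Real.le_logb_iff_rpow_le one_lt_two (by positivity), le_div_iff₀ hε]
    norm_num
    linarith
  have hell : 1 ≤ Real.logb 2 (Real.logb 2 (1 / ε)) := by
    rw [Real.le_logb_iff_rpow_le one_lt_two (by linarith), Real.rpow_one]
    exact hlam
  have hel : Real.logb 2 (Real.logb 2 (1 / ε)) ≤ Real.logb 2 (1 / ε) := by
    rw [Real.logb_le_iff_le_rpow one_lt_two (by linarith)]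
    have h := one_add_mul_self_le_rpow_one_add (s := 1) (by norm_num)
      (by linarith : 1 ≤ Real.logb 2 (1 / ε))
    norm_num at h ⊢
    linarith
  set lam := Real.logb 2 (1 / ε)
  set ell := Real.logb 2 lam
  rcases Nat.eq_zero_or_pos n with rfl | hn
  · -- Without basis vectors there is nothing to compute; here `Real.logb 2 0 = 0`. The general
    -- network does not obey the bound, since its padding of `Φfg` costs `2 * N` for each layer.
    refine ⟨.output 0 0, fun μ _ => ?_, ?_, ?_⟩
    · rw [PODDNN.vecNorm, show ∀ v : Fin 0 → ℝ, WithLp.toLp 2 v = 0 from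
        fun v => Subsingleton.elim _ _, norm_zero]
      exact hε.le
    · have h1 : (1 : ℝ) ≤ (ΦB (PODDNN.tol₃ α β γ ε)).depth := by
        exact_mod_cast (NetFn.of_reluNet (ΦB (PODDNN.tol₃ α β γ ε))).depth_pos
      have h2 : 0 ≤ Real.logb 2 ((NI + NB : ℕ) : ℝ) := by
        rw [Real.logb]
        exact div_nonneg (Real.log_natCast_nonneg _) (Real.log_nonneg one_le_two)
      simp only [ReLUNet.depth, Nat.cast_one, Nat.cast_zero, Real.logb_zero, add_zero]
      have h3 : 0 ≤ 2 * (C + 9) * (C' + 3) * ell * lam := by positivity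
      have h4 : 0 ≤ 2 * (C + 9) * (C' + 3) * Real.logb 2 ((NI + NB : ℕ) : ℝ) := by positivity
      linarith [Nat.cast_nonneg (α := ℝ) (ΦB (PODDNN.tol₁ α β γ ε)).depth,
        Nat.cast_nonneg (α := ℝ) (Φfg (PODDNN.tol₂ α β γ ε)).depth]
    · have h1 : (ReLUNet.output (0 : Matrix (Fin 0) (Fin p) ℝ) 0).numParams = 0 := by
        simp [ReLUNet.numParams, ReLUNet.nnz]
      rw [h1]
      simp only [Nat.cast_zero]
      ring_nf
      positivity
  have hnN : n ≤ NI + NB := le_of_transpose_mul_self_eq_one hV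
  obtain ⟨m₁, hm₁, hm₁'⟩ := hbits (NI + NB) ε (by omega) hε hε1
  obtain ⟨m₂, hm₂, hm₂'⟩ := hbits n ε hn hε hε1
  obtain ⟨K, hK, hK'⟩ := hsteps ε hε hε1
  obtain ⟨Φ, hΦ, hdepth, hparams⟩ := NetFn.exists_reluNet_lsqApprox (ΦB (PODDNN.tol₁ α β γ ε))
    (ΦB (PODDNN.tol₃ α β γ ε)) (Φfg (PODDNN.tol₂ α β γ ε)) Z (α ^ 2)⁻¹ m₁ m₂ K
  have hn1 : (1 : ℝ) ≤ n := by exact_mod_cast hn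
  have hnN' : (n : ℝ) ≤ ((NI + NB : ℕ) : ℝ) := by exact_mod_cast hnN
  have ha : 0 ≤ Real.logb 2 (n : ℝ) := Real.logb_nonneg one_lt_two hn1
  have hb : 0 ≤ Real.logb 2 ((NI + NB : ℕ) : ℝ) := Real.logb_nonneg one_lt_two (hn1.trans hnN')
  refine ⟨Φ, fun μ hμ => ?_, ?_, ?_⟩
  · rw [hΦ]
    refine PODDNN.norm_leastSquares_sub_lsqApprox_le hβ hαβ hγ hε hε1 hP hn (hspec μ hμ)
      (hdata μ hμ) (hΦB _ (PODDNN.tol₁_pos hα hβ hγ hε) μ hμ)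
      (hΦfg _ (PODDNN.tol₂_pos hα hβ hγ hε) μ hμ) (hΦB _ (PODDNN.tol₃_pos hα hβ hγ hε) μ hμ)
      (le_trans ?_ hm₁) (le_trans (le_of_eq (by ring)) hm₂) hK
    have hNN : (n : ℝ) * n * ((NI + NB : ℕ) : ℝ) ≤ ((NI + NB : ℕ) : ℝ) ^ 3 := by
      calc _ ≤ ((NI + NB : ℕ) : ℝ) * ((NI + NB : ℕ) : ℝ) * ((NI + NB : ℕ) : ℝ) := by gcongr
        _ = _ := by ring
    rw [← mul_assoc]
    exact mul_le_mul_of_nonneg_right hNN (by positivity)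
  · have h := depth_bound hC hC' hlam hell ha hb (Nat.cast_nonneg m₂) hm₁' hm₂' hK'
    rw [hdepth]
    push_cast at h ⊢
    linarith
  · have h₁ := arithmetic_params_bound hC hC' hlam hell hel ha hb (Nat.cast_nonneg m₁)
      (Nat.cast_nonneg m₂) hm₁' hm₂' hK' hn1 hnN'
    have h₂ := data_params_bound (Nat.cast_nonneg (ΦB (PODDNN.tol₁ α β γ ε)).numParams)
      (Nat.cast_nonneg (Φfg (PODDNN.tol₂ α β γ ε)).numParams)
      (Nat.cast_nonneg (ΦB (PODDNN.tol₃ α β γ ε)).numParams)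
      (Nat.cast_nonneg (ΦB (PODDNN.tol₁ α β γ ε)).depth)
      (Nat.cast_nonneg (Φfg (PODDNN.tol₂ α β γ ε)).depth)
      (Nat.cast_nonneg (ΦB (PODDNN.tol₃ α β γ ε)).depth) hn1 hnN'
    have h₃ : (Φ.numParams : ℝ) ≤ _ := Nat.cast_le.2 hparams
    push_cast at h₁ h₂ h₃ ⊢
    linarith
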